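/- Let $k\ge 0$ and let $\Lambda$ be a row-finite $k$-graph with no sources: $\Lambda$ is a nonempty countable small category with a degree functor $d:\Lambda\to\mathbb N^k$ having the factorisation property (if $d(\lambda)=m+n$ there are unique $\mu,\nu$ with $d(\mu)=m$, $d(\nu)=n$, $\lambda=\mu\nu$), vertices are identified with the elements of degree $0$, and for every vertex $v$ and $n\in\mathbb N^k$ the set $v\Lambda^n$ of elements of degree $n$ with range $v$ is finite and nonempty. Let $c$ be a normalised $\mathbb T$-valued categorical $2$-cocycle on $\Lambda$: $c(\mu,\nu)c(\mu\nu,\xi)=c(\nu,\xi)c(\mu,\nu\xi)$ for all composable triples $(\mu,\nu,\xi)$, and $c(\mu,\nu)=1$ if $s(\mu)=r(\nu)$ and $\mu$ or $\nu$ is a vertex. Let $C^*(\Lambda,c)$ be the universal $C^*$-algebra generated by elements $s_\lambda$ ($\lambda\in\Lambda$) such that the $s_v$ ($v$ a vertex) are mutually orthogonal projections, $s_\mu s_\nu=c(\mu,\nu)s_{\mu\nu}$ whenever $s(\mu)=r(\nu)$, $s_\lambda^*s_\lambda=s_{s(\lambda)}$, and $s_v=\sum_{\lambda\in v\Lambda^n}s_\lambda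 s_\lambda^*$ for all vertices $v$ and $n\in\mathbb N^k$. Let $\Lambda^\infty$ be the set of degree-preserving functors $x$ from $\Omega_k=\{(m,n)\in\mathbb N^k\times\mathbb N^k: m\le n\}$ to $\Lambda$, with $r(x)=x(0,0)$ and shifts $(\sigma^p x)(m,n)=x(m+p,n+p)$, and let $$\mathcal G_\Lambda=\{(x,\ell-m,y)\in\Lambda^\infty\times\mathbb Z^k\times\Lambda^\infty:\ \ell,m\in\mathbb N^k,\ \sigma^\ell x=\sigma^m y\}$$ be the path groupoid, with $(x,p,y)(y,q,z)=(x,p+q,z)$, $(x,p,y)^{-1}=(y,-p,x)$, and the topology with basis the sets $Z(\mu,\nu)=\{(\mu x,d(\mu)-d(\nu),\nu x): x\in\Lambda^\infty,\ r(x)=s(\mu)\}$, $s(\mu)=s(\nu)$. Let $\mathcal P$ be a set of pairs $(\mu,\nu)\in\Lambda\times\Lambda$ with $s(\mu)=s(\nu)$ which contains $(\lambda,s(\lambda))$ for every $\lambda\in\Lambda$, such that each $g\in\mathcal G_\Lambda$ lies in $Z(\mu_g,\nu_g)$ for exactly one $(\mu_g,\nu_g)\in\mathcal P$. Let $\sigma_c$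 be the continuous $\mathbb T$-valued groupoid $2$-cocycle given by $$\sigma_c(g,h)=c(\mu_g,\alpha)\overline{c(\nu_g,\alpha)}\;c(\mu_h,\beta)\overline{c(\nu_h,\beta)}\;\overline{c(\mu_{gh},\gamma)}\,c(\nu_{gh},\gamma)$$ for any $\alpha,\beta,\gamma\in\Lambda$ and $y\in\Lambda^\infty$ such that $r(\alpha)=s(\mu_g)$, $r(\beta)=s(\mu_h)$, $r(\gamma)=s(\mu_{gh})$, $s(\alpha)=s(\beta)=s(\gamma)=r(y)$, $\mu_g\alpha=\mu_{gh}\gamma$, $\nu_h\beta=\nu_{gh}\gamma$, $\nu_g\alpha=\mu_h\beta$, $g=(\mu_g\alpha y,d(\mu_g)-d(\nu_g),\nu_g\alpha y)$, $h=(\mu_h\beta y,d(\mu_h)-d(\nu_h),\nu_h\beta y)$ and $gh=(\mu_{gh}\gamma y,d(\mu_{gh})-d(\nu_{gh}),\nu_{gh}\gamma y)$ (such elements exist and the value does not depend on their choice). Let $C^*(\mathcal G_\Lambda,\sigma_c)$ be Renault's twisted groupoid $C^*$-algebra: the completion of $C_c(\mathcal G_\Lambda)$, with $(f*g)(\gamma)=\sum_{\alpha\beta=\gamma}\sigma_c(\alpha,\beta)f(\alpha)g(\beta)$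 and $f^*(\gamma)=\overline{\sigma_c(\gamma^{-1},\gamma)}\,\overline{f(\gamma^{-1})}$, in the supremum of the norms $\|L(f)\|$ over all $*$-representations $L$ bounded by the $I$-norm $\max\big(\sup_x\sum_{r(g)=x}|f(g)|,\ \sup_x\sum_{s(g)=x}|f(g)|\big)$. Then there is a surjective $*$-homomorphism $\pi:C^*(\Lambda,c)\to C^*(\mathcal G_\Lambda,\sigma_c)$ such that $\pi(s_\lambda)=1_{Z(\lambda,s(\lambda))}$ for all $\lambda\in\Lambda$ (the indicator functions $1_{Z(\mu,\nu)}$ being continuous with compact support). Moreover, for all $\mu,\nu\in\Lambda$ with $s(\mu)=s(\nu)$ there are a finite set $F$ of elements of $\Lambda$ with range $s(\mu)$ such that $Z(\mu,\nu)$ is the disjoint union of the sets $Z(\mu\tau,\nu\tau)$, $\tau\in F$, and a function $a:F\to\mathbb T$ such that $\pi(s_\mu s_\nu^*)=\sum_{\tau\in F}a_\tau 1_{Z(\mu\tau,\nu\tau)}$. Furthermore, for every row-finite $k$-graph $\Lambda$ with no sources and every such $c$ (no $\mathcal P$ being given), $s_\lambda\ne 0$ in $C^*(\Lambda,c)$ for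 all $\lambda\in\Lambda$. -/

import Mathlib

universe u

open scoped ENNReal CompactlySupported

/-- A `k`-graph: a nonempty countable small category `Λ` with a degree functor to `ℕ^k` that has the
factorisation property. The category is given by its morphisms only: an object is identified with
its identity morphism, so the range (codomain) `r μ` and the source (domain) `s μ` are themselves
elements of `Λ`. The value `comp μ ν` is meaningful only if `s μ = r ν`, and every law about
composites is required only then. -/
class KGraph (k : outParam ℕ) (Λ : Type u) where
  nonempty : Nonempty Λ
  countable : Countable Λ
  /-- degree -/
  deg : Λ → Fin k → ℕ
  /-- range -/
  r : Λ → Λ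
  /-- source -/
  s : Λ → Λ
  /-- composition `μν`, for `s μ = r ν` -/
  comp : Λ → Λ → Λ
  r_r : ∀ μ, r (r μ) = r μ
  s_r : ∀ μ, s (r μ) = r μ
  r_s : ∀ μ, r (s μ) = s μ
  s_s : ∀ μ, s (s μ) = s μ
  r_comp_self : ∀ μ, comp (r μ) μ = μ
  self_comp_s : ∀ μ, comp μ (s μ) = μ
  r_comp : ∀ μ ν, s μ = r ν → r (comp μ ν) = r μ
  s_comp : ∀ μ ν, s μ = r ν → s (comp μ ν) = s ν
  comp_assoc : ∀ μ ν ξ, s μ = r ν → s ν = r ξ → comp (comp μ ν) ξ = comp μ (comp ν ξ)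
  deg_r : ∀ μ, deg (r μ) = 0
  deg_comp : ∀ μ ν, s μ = r ν → deg (comp μ ν) = deg μ + deg ν
  factorisation : ∀ (μ : Λ) (m n : Fin k → ℕ), deg μ = m + n →
    ∃! p : Λ × Λ, s p.1 = r p.2 ∧ deg p.1 = m ∧ deg p.2 = n ∧ comp p.1 p.2 = μ

namespace KGraph

section Basic

variable {k : ℕ} {Λ : Type u} [KGraph k Λ]

/-- The set `vΛ^n` of elements of degree `n` with range `v`. -/
def into (v : Λ) (n : Fin k → ℕ) : Set Λ := {μ | r μ = v ∧ deg μ = n}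

variable (Λ) in
/-- `vΛ^n` is finite for all vertices `v` and all `n`. -/
def RowFinite : Prop := ∀ (v : Λ) (n : Fin k → ℕ), deg v = 0 → (into v n).Finite

variable (Λ) in
/-- `vΛ^n` is nonempty for all vertices `v` and all `n`. -/
def NoSources : Prop := ∀ (v : Λ) (n : Fin k → ℕ), deg v = 0 → (into v n).Nonempty

/-- `c` is a normalised categorical `2`-cocycle on `Λ` with values in the circle group. Only the
values `c μ ν` with `s μ = r ν` carry meaning. -/
structure IsTwoCocycle (c : Λ → Λ → Circle) : Prop where
  normalised : ∀ μ ν, s μ = r ν → deg μ = 0 ∨ deg ν = 0 → c μ ν = 1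
  cocycle : ∀ μ ν ξ, s μ = r ν → s ν = r ξ →
    c μ ν * c (comp μ ν) ξ = c ν ξ * c μ (comp ν ξ)

/-- `t` is a Cuntz-Krieger `(Λ, c)`-family in the C*-algebra `B`. (For row-finite `Λ` the sum in
`ck4` is a finite sum.) -/
structure IsCKFamily (c : Λ → Λ → Circle) {B : Type*} [NonUnitalCStarAlgebra B] (t : Λ → B) :
    Prop where
  ck1_proj : ∀ v, deg v = 0 → IsStarProjection (t v)
  ck1_orth : ∀ v w, deg v = 0 → deg w = 0 → v ≠ w → t v * t w = 0
  ck2 : ∀ μ ν, s μ = r ν → t μ * t ν = (c μ ν : ℂ) • t (comp μ ν)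
  ck3 : ∀ μ, star (t μ) * t μ = t (s μ)
  ck4 : ∀ (v : Λ) (n : Fin k → ℕ), deg v = 0 → t v = ∑ᶠ μ ∈ into v n, t μ * star (t μ)

theorem deg_s (μ : Λ) : deg (s μ) = 0 := by
  rw [← r_s]; exact deg_r _

theorem IsCKFamily.norm_le_one {c : Λ → Λ → Circle} {B : Type*} [NonUnitalCStarAlgebra B]
    {t : Λ → B} (ht : IsCKFamily c t) (μ : Λ) : ‖t μ‖ ≤ 1 := by
  have h1 : ‖t μ‖ * ‖t μ‖ ≤ 1 := by
    rw [← CStarRing.norm_star_mul_self, ht.ck3]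
    exact (ht.ck1_proj _ (deg_s μ)).norm_le
  nlinarith [norm_nonneg (t μ)]

end Basic

/-! ### The twisted C*-algebra of a `k`-graph -/

section TwistedAlgebra

variable {k : ℕ} {Λ : Type u} [KGraph k Λ]

/-- A C*-algebra together with a Cuntz-Krieger `(Λ, c)`-family in it. -/
structure CKRep (c : Λ → Λ → Circle) : Type (u + 1) where
  B : Type u
  [alg : NonUnitalCStarAlgebra B]
  t : Λ → B
  isCK : IsCKFamily c t

attribute [instance] CKRep.alg

/-- The direct product of all Cuntz-Krieger `(Λ, c)`-families, as an element of the
`ℓ^∞`-product of C*-algebras. -/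
noncomputable def genAux (c : Λ → Λ → Circle) (μ : Λ) : lp (fun R : CKRep c => R.B) ∞ :=
  ⟨fun R => R.t μ, memℓp_infty ⟨1, by rintro _ ⟨R, rfl⟩; exact R.isCK.norm_le_one μ⟩⟩

/-- The universal C*-algebra `C*(Λ, c)` generated by a Cuntz-Krieger `(Λ, c)`-family: the
C*-subalgebra generated by the direct product of all such families. (Every family generates a
separable C*-algebra, which has an isomorphic copy in `Type u`.) -/
noncomputable def TwistedCStar (c : Λ → Λ → Circle) :
    NonUnitalStarSubalgebra ℂ (lp (fun R : CKRep c => R.B) ∞) :=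
  (NonUnitalStarAlgebra.adjoin ℂ (Set.range (genAux c))).topologicalClosure

noncomputable instance (c : Λ → Λ → Circle) : NonUnitalCStarAlgebra (TwistedCStar c) :=
  NonUnitalStarSubalgebra.nonUnitalCStarAlgebra _
    (h_closed := NonUnitalStarSubalgebra.isClosed_topologicalClosure _)

/-- The universal generators `s_μ` of `C*(Λ, c)`. -/
noncomputable def gen (c : Λ → Λ → Circle) (μ : Λ) : TwistedCStar c :=
  ⟨genAux c μ, NonUnitalStarSubalgebra.le_topologicalClosure _
    (NonUnitalStarAlgebra.subset_adjoin ℂ _ (Set.mem_range_self μ))⟩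

theorem isCKFamily_gen (hfin : RowFinite Λ) (c : Λ → Λ → Circle) : IsCKFamily c (gen c) where
  ck1_proj v hv :=
    ⟨Subtype.ext <| lp.ext <| funext fun R => (R.isCK.ck1_proj v hv).isIdempotentElem,
      Subtype.ext <| lp.ext <| funext fun R => (R.isCK.ck1_proj v hv).isSelfAdjoint⟩
  ck1_orth v w hv hw h :=
    Subtype.ext <| lp.ext <| funext fun R => R.isCK.ck1_orth v w hv hw h
  ck2 μ ν h := Subtype.ext <| lp.ext <| funext fun R => R.isCK.ck2 μ ν h
  ck3 μ := Subtype.ext <| lp.ext <| funext fun R => R.isCK.ck3 μ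
  ck4 v n hv := by
    rw [finsum_mem_eq_finite_toFinset_sum _ (hfin v n hv)]
    refine Subtype.ext <| lp.ext <| funext fun R => ?_
    have h := R.isCK.ck4 v n hv
    rw [finsum_mem_eq_finite_toFinset_sum _ (hfin v n hv)] at h
    rw [AddSubmonoidClass.coe_finsetSum, lp.coeFn_sum, Finset.sum_apply]
    exact h

/-- The universal property of `C*(Λ, c)`. -/
theorem exists_hom_of_isCKFamily {c : Λ → Λ → Circle} {B : Type u} [NonUnitalCStarAlgebra B]
    {t : Λ → B} (ht : IsCKFamily c t) :
    ∃ φ : TwistedCStar c →⋆ₙₐ[ℂ] B, ∀ μ, φ (gen c μ) = t μ :=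
  ⟨{ toFun := fun a => a.1 ⟨B, t, ht⟩
     map_smul' := fun _ _ => rfl
     map_zero' := rfl
     map_add' := fun _ _ => rfl
     map_mul' := fun _ _ => rfl
     map_star' := fun _ => rfl }, fun _ => rfl⟩

end TwistedAlgebra

/-! ### Infinite paths and the path groupoid -/

/-- An infinite path: a `k`-graph morphism from `Ω_k = {(m, n) : m ≤ n}` to `Λ`. -/
@[ext]
structure InfPath {k : ℕ} (Λ : Type u) [KGraph k Λ] where
  seg : ∀ m n : Fin k → ℕ, m ≤ n → Λ
  r_seg : ∀ m n h, r (seg m n h) = seg m m le_rfl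
  s_seg : ∀ m n h, s (seg m n h) = seg n n le_rfl
  comp_seg : ∀ m n p (h : m ≤ n) (h' : n ≤ p),
    comp (seg m n h) (seg n p h') = seg m p (h.trans h')
  deg_seg : ∀ m n h, deg (seg m n h) = n - m

namespace InfPath

variable {k : ℕ} {Λ : Type u} [KGraph k Λ]

/-- The shift `σ^p`. -/
def shift (p : Fin k → ℕ) (x : InfPath Λ) : InfPath Λ where
  seg m n h := x.seg (m + p) (n + p) (by gcongr)
  r_seg _ _ _ := x.r_seg _ _ _
  s_seg _ _ _ := x.s_seg _ _ _
  comp_seg _ _ _ _ _ := x.comp_seg _ _ _ _ _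
  deg_seg m n h := by rw [x.deg_seg, add_tsub_add_eq_tsub_right]

/-- The range `x(0)` of an infinite path. -/
def range (x : InfPath Λ) : Λ := x.seg 0 0 le_rfl

/-- `y = μx`: the path `y` has initial segment `μ`, followed by `x`. For `r(x) = s(μ)` there is
exactly one such `y`. -/
def IsConcat (μ : Λ) (x y : InfPath Λ) : Prop :=
  y.seg 0 (deg μ) zero_le = μ ∧ y.shift (deg μ) = x

theorem shift_shift (p q : Fin k → ℕ) (x : InfPath Λ) :
    (x.shift p).shift q = x.shift (p + q) := by
  ext m n h
  simp only [shift, add_assoc, add_comm q p]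

theorem seg_congr (x : InfPath Λ) {m m' n n' : Fin k → ℕ} (hm : m = m') (hn : n = n') (h : m ≤ n) :
    x.seg m n h = x.seg m' n' (hm ▸ hn ▸ h) := by
  subst hm; subst hn; rfl

theorem eq_of_comp_eq {a b a' b' : Λ} (h : s a = r b) (h' : s a' = r b')
    (ha : deg a = deg a') (hb : deg b = deg b') (hc : comp a b = comp a' b') :
    a = a' ∧ b = b' := by
  obtain ⟨p, -, hp⟩ := factorisation (comp a b) (deg a) (deg b) (deg_comp _ _ h)
  have h1 := hp (a, b) ⟨h, rfl, rfl, rfl⟩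
  have h2 := hp (a', b') ⟨h', ha.symm, hb.symm, hc.symm⟩
  have := h1.trans h2.symm
  exact ⟨congrArg Prod.fst this, congrArg Prod.snd this⟩

/-- An infinite path is determined by an initial segment and the remaining path. -/
theorem eq_of_shift_eq {y y' : InfPath Λ} (n : Fin k → ℕ)
    (h0 : y.seg 0 n zero_le = y'.seg 0 n zero_le) (h : y.shift n = y'.shift n) :
    y = y' := by
  have hcomp : ∀ (z : InfPath Λ) (a b c : Fin k → ℕ) (hab : a ≤ b) (hbc : b ≤ c),
      s (z.seg a b hab) = r (z.seg b c hbc) := by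
    intro z a b c hab hbc
    rw [z.s_seg, z.r_seg]
  have hall : ∀ p : Fin k → ℕ, y.seg 0 p zero_le = y'.seg 0 p zero_le := by
    intro p
    have hn : n ≤ p + n := le_add_of_nonneg_left zero_le
    have hp : p ≤ p + n := le_add_of_nonneg_right zero_le
    have h2 : y.seg n (p + n) hn = y'.seg n (p + n) hn := by
      have := congrArg (fun z : InfPath Λ => z.seg 0 p zero_le) h
      simp only [shift] at this
      rw [y.seg_congr (zero_add n) rfl, y'.seg_congr (zero_add n) rfl] at this
      exact this
    have h3 : y.seg 0 (p + n) zero_le = y'.seg 0 (p + n) zero_le := by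
      rw [← y.comp_seg 0 n (p + n) zero_le hn, ← y'.comp_seg 0 n (p + n) zero_le hn, h0, h2]
    rw [← y.comp_seg 0 p (p + n) zero_le hp, ← y'.comp_seg 0 p (p + n) zero_le hp] at h3
    exact (eq_of_comp_eq (hcomp _ _ _ _ _ _) (hcomp _ _ _ _ _ _)
      (by rw [y.deg_seg, y'.deg_seg]) (by rw [y.deg_seg, y'.deg_seg]) h3).1
  ext m p hmp
  have h3 := hall p
  rw [← y.comp_seg 0 m p zero_le hmp, ← y'.comp_seg 0 m p zero_le hmp] at h3
  exact (eq_of_comp_eq (hcomp _ _ _ _ _ _) (hcomp _ _ _ _ _ _)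
      (by rw [y.deg_seg, y'.deg_seg]) (by rw [y.deg_seg, y'.deg_seg]) h3).2

end InfPath

/-- The path groupoid `G_Λ`, whose elements are the triples `(x, ℓ - m, y)` with
`σ^ℓ x = σ^m y`. -/
@[ext]
structure PathGroupoid {k : ℕ} (Λ : Type u) [KGraph k Λ] where
  rng : InfPath Λ
  lag : Fin k → ℤ
  src : InfPath Λ
  exists_shift : ∃ l m : Fin k → ℕ,
    (lag = fun i => (l i : ℤ) - (m i : ℤ)) ∧ rng.shift l = src.shift m

namespace PathGroupoid

variable {k : ℕ} {Λ : Type u} [KGraph k Λ]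

/-- The product `(x, m, y)(y, n, z) = (x, m + n, z)`. -/
def mul (g h : PathGroupoid Λ) (e : g.src = h.rng) : PathGroupoid Λ where
  rng := g.rng
  lag := g.lag + h.lag
  src := h.src
  exists_shift := by
    obtain ⟨l, m, h1, h2⟩ := g.exists_shift
    obtain ⟨p, q, h3, h4⟩ := h.exists_shift
    refine ⟨l + p, q + m, ?_, ?_⟩
    · rw [h1, h3]; ext i; simp only [Pi.add_apply]; push_cast; ring
    · rw [← InfPath.shift_shift, h2, InfPath.shift_shift, e, add_comm m p, ← InfPath.shift_shift,
        h4, InfPath.shift_shift]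

/-- The inverse `(x, m, y)⁻¹ = (y, -m, x)`. -/
def inv (g : PathGroupoid Λ) : PathGroupoid Λ where
  rng := g.src
  lag := -g.lag
  src := g.rng
  exists_shift := by
    obtain ⟨l, m, h1, h2⟩ := g.exists_shift
    refine ⟨m, l, ?_, h2.symm⟩
    rw [h1]; ext i; simp

/-- `g = (μx, d(μ) - d(ν), νx)`. -/
def IsTriple (μ ν : Λ) (x : InfPath Λ) (g : PathGroupoid Λ) : Prop :=
  InfPath.IsConcat μ x g.rng ∧ (g.lag = fun i => (deg μ i : ℤ) - (deg ν i : ℤ)) ∧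
    InfPath.IsConcat ν x g.src

/-- The basic set `Z(μ, ν) = {(μx, d(μ) - d(ν), νx) : r(x) = s(μ)}`. -/
def Z (μ ν : Λ) : Set (PathGroupoid Λ) :=
  {g | ∃ x : InfPath Λ, x.range = s μ ∧ IsTriple μ ν x g}

/-- The topology with the sets `Z(μ, ν)`, for `s(μ) = s(ν)`, as a basis. -/
instance : TopologicalSpace (PathGroupoid Λ) :=
  TopologicalSpace.generateFrom {U | ∃ μ ν : Λ, s μ = s ν ∧ U = Z μ ν}

/-! ### The groupoid cocycle of a categorical cocycle -/

/-- `{Z(μ, ν) : (μ, ν) ∈ P}` is a partition of the path groupoid, for a set `P` of pairs `(μ, ν)`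
with `s(μ) = s(ν)`: each `g` lies in `Z(μ, ν)` for exactly one `(μ, ν) ∈ P`. -/
structure IsPartition (P : Set (Λ × Λ)) : Prop where
  source_eq : ∀ p ∈ P, s p.1 = s p.2
  existsUnique : ∀ g : PathGroupoid Λ, ∃! p : Λ × Λ, p ∈ P ∧ g ∈ Z p.1 p.2

/-- `z = c(μ_g, α) c(ν_g, α)⁻¹ c(μ_h, β) c(ν_h, β)⁻¹ (c(μ_{gh}, γ) c(ν_{gh}, γ)⁻¹)⁻¹`, where
`p = (μ_g, ν_g)`, `q = (μ_h, ν_h)`, `w = (μ_{gh}, ν_{gh})` are the elements of `P` such that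
`g ∈ Z(μ_g, ν_g)`, `h ∈ Z(μ_h, ν_h)`, `gh ∈ Z(μ_{gh}, ν_{gh})`, and `α`, `β`, `γ` are finite paths
such that, for some infinite path `y`,
`g = (μ_g α y, d(μ_g) - d(ν_g), ν_g α y)`, `h = (μ_h β y, d(μ_h) - d(ν_h), ν_h β y)` and
`gh = (μ_{gh} γ y, d(μ_{gh}) - d(ν_{gh}), ν_{gh} γ y)`. -/
def IsCocycleValue (P : Set (Λ × Λ)) (c : Λ → Λ → Circle) (g h : PathGroupoid Λ) (z : Circle) :
    Prop :=
  ∃ (e : g.src = h.rng) (p q w : Λ × Λ) (α β γ : Λ) (y : InfPath Λ),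
    (p ∈ P ∧ g ∈ Z p.1 p.2) ∧ (q ∈ P ∧ h ∈ Z q.1 q.2) ∧ (w ∈ P ∧ g.mul h e ∈ Z w.1 w.2) ∧
    (r α = s p.1 ∧ r β = s q.1 ∧ r γ = s w.1) ∧
    (s α = y.range ∧ s β = y.range ∧ s γ = y.range) ∧
    (comp p.1 α = comp w.1 γ ∧ comp q.2 β = comp w.2 γ ∧ comp p.2 α = comp q.1 β) ∧
    IsTriple (comp p.1 α) (comp p.2 α) y g ∧
    IsTriple (comp q.1 β) (comp q.2 β) y h ∧
    IsTriple (comp w.1 γ) (comp w.2 γ) y (g.mul h e) ∧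
    z = c p.1 α * (c p.2 α)⁻¹ * (c q.1 β * (c q.2 β)⁻¹) * (c w.1 γ * (c w.2 γ)⁻¹)⁻¹

open Classical in
/-- The groupoid `2`-cocycle `σ_c` constructed from `P`. If `P` gives a partition and `c` is a
`2`-cocycle, then each composable pair `(g, h)` has exactly one cocycle value; pairs that are not
composable get the irrelevant value `1`. -/
noncomputable def twist (P : Set (Λ × Λ)) (c : Λ → Λ → Circle) (g h : PathGroupoid Λ) : Circle :=
  if H : ∃ z, IsCocycleValue P c g h z then H.choose else 1

/-! ### The twisted groupoid C*-algebra -/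

/-- The twisted convolution product `(f * g)(γ) = ∑_{αβ = γ} σ(α, β) f(α) g(β)` (a finite sum for
compactly supported `f` and `g`). -/
noncomputable def conv (σ : PathGroupoid Λ → PathGroupoid Λ → Circle)
    (f g : PathGroupoid Λ → ℂ) (γ : PathGroupoid Λ) : ℂ :=
  ∑ᶠ p : {p : PathGroupoid Λ × PathGroupoid Λ // ∃ e : p.1.src = p.2.rng, p.1.mul p.2 e = γ},
    (σ p.1.1 p.1.2 : ℂ) * f p.1.1 * g p.1.2

/-- The twisted involution, with values `conj (σ(γ⁻¹, γ)) conj (f(γ⁻¹))`. -/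
noncomputable def invol (σ : PathGroupoid Λ → PathGroupoid Λ → Circle)
    (f : PathGroupoid Λ → ℂ) (γ : PathGroupoid Λ) : ℂ :=
  star (σ γ.inv γ : ℂ) * star (f γ.inv)

/-- The `I`-norm: the larger one of `sup_x ∑_{r(g) = x} |f(g)|` and `sup_x ∑_{s(g) = x} |f(g)|`. -/
noncomputable def iNorm (f : PathGroupoid Λ → ℂ) : ℝ≥0∞ :=
  max (⨆ x : InfPath Λ, ∑' g : {g : PathGroupoid Λ // g.rng = x}, ‖f g.1‖ₑ)
    (⨆ x : InfPath Λ, ∑' g : {g : PathGroupoid Λ // g.src = x}, ‖f g.1‖ₑ)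

/-- A bounded representation of the convolution `*`-algebra `C_c(G_Λ, σ)` in a C*-algebra: a linear
map which is multiplicative for the twisted convolution, preserves the twisted involution, and is
bounded by the `I`-norm. (As `C_c(G_Λ)` is closed under convolution and involution when `σ` is a
continuous cocycle, `h` runs through all the products and all the adjoints.) -/
structure Rep (σ : PathGroupoid Λ → PathGroupoid Λ → Circle) : Type (u + 1) where
  B : Type u
  [alg : NonUnitalCStarAlgebra B]
  L : C_c(PathGroupoid Λ, ℂ) →ₗ[ℂ] B
  map_conv : ∀ f g h : C_c(PathGroupoid Λ, ℂ), (⇑h = conv σ f g) → L h = L f * L g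
  map_invol : ∀ f h : C_c(PathGroupoid Λ, ℂ), (⇑h = invol σ f) → L h = star (L f)
  bounded : ∀ f : C_c(PathGroupoid Λ, ℂ), ‖L f‖ₑ ≤ iNorm f

attribute [instance] Rep.alg

theorem isOpen_Z {μ ν : Λ} (h : s μ = s ν) : IsOpen (Z μ ν) :=
  TopologicalSpace.isOpen_generateFrom_of_mem ⟨μ, ν, h, rfl⟩

theorem exists_mem_Z (g : PathGroupoid Λ) : ∃ p : Λ × Λ, s p.1 = s p.2 ∧ g ∈ Z p.1 p.2 := by
  obtain ⟨l, m, h1, h2⟩ := g.exists_shift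
  have hl : deg (g.rng.seg 0 l zero_le) = l := by rw [InfPath.deg_seg]; simp
  have hm : deg (g.src.seg 0 m zero_le) = m := by rw [InfPath.deg_seg]; simp
  have hr : g.rng.seg l l le_rfl = (g.rng.shift l).range := by
    simp only [InfPath.range, InfPath.shift]
    exact InfPath.seg_congr _ (zero_add l).symm (zero_add l).symm _
  have hs : g.src.seg m m le_rfl = (g.src.shift m).range := by
    simp only [InfPath.range, InfPath.shift]
    exact InfPath.seg_congr _ (zero_add m).symm (zero_add m).symm _
  refine ⟨(g.rng.seg 0 l zero_le, g.src.seg 0 m zero_le), ?_, g.rng.shift l, ?_, ?_, ?_, ?_⟩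
  · simp only
    rw [InfPath.s_seg, InfPath.s_seg, hr, hs, h2]
  · simp only
    rw [InfPath.s_seg, hr]
  · exact ⟨InfPath.seg_congr _ rfl hl _, by simp only [hl]⟩
  · simp only [hl, hm, h1]
  · exact ⟨InfPath.seg_congr _ rfl hm _, by simp only [hm, h2]⟩

theorem eq_of_mem_Z_of_rng {μ ν : Λ} {g h : PathGroupoid Λ} (hg : g ∈ Z μ ν) (hh : h ∈ Z μ ν)
    (e : g.rng = h.rng) : g = h := by
  obtain ⟨x, -, hx1, hx2, hx3⟩ := hg
  obtain ⟨y, -, hy1, hy2, hy3⟩ := hh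
  have hxy : x = y := by rw [← hx1.2, ← hy1.2, e]
  refine PathGroupoid.ext e (hx2.trans hy2.symm) ?_
  exact InfPath.eq_of_shift_eq (deg ν) (hx3.1.trans hy3.1.symm) (hx3.2.trans (hxy.trans hy3.2.symm))

theorem eq_of_mem_Z_of_src {μ ν : Λ} {g h : PathGroupoid Λ} (hg : g ∈ Z μ ν) (hh : h ∈ Z μ ν)
    (e : g.src = h.src) : g = h := by
  obtain ⟨x, -, hx1, hx2, hx3⟩ := hg
  obtain ⟨y, -, hy1, hy2, hy3⟩ := hh
  have hxy : x = y := by rw [← hx3.2, ← hy3.2, e]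
  refine PathGroupoid.ext ?_ (hx2.trans hy2.symm) e
  exact InfPath.eq_of_shift_eq (deg μ) (hx1.1.trans hy1.1.symm) (hx1.2.trans (hxy.trans hy1.2.symm))

/-- The `I`-norm of a compactly supported continuous function is finite. -/
theorem iNorm_ne_top (f : C_c(PathGroupoid Λ, ℂ)) : iNorm f ≠ ⊤ := by
  classical
  obtain ⟨C, hC⟩ := f.hasCompactSupport.exists_bound_of_continuous f.continuous
  obtain ⟨T, hT⟩ := f.hasCompactSupport.isCompact.elim_finite_subcover
    (fun p : {p : Λ × Λ // s p.1 = s p.2} => Z p.1.1 p.1.2) (fun p => isOpen_Z p.2)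
    (fun g _ => by
      obtain ⟨p, hp, hg⟩ := exists_mem_Z g
      exact Set.mem_iUnion.2 ⟨⟨p, hp⟩, hg⟩)
  have hpt : ∀ g, ‖f g‖ₑ ≤ ∑ p ∈ T, Set.indicator (Z p.1.1 p.1.2) (fun _ => ENNReal.ofReal C) g := by
    intro g
    by_cases hg : f g = 0
    · simp [hg]
    · have hg' := hT (subset_tsupport _ (Function.mem_support.2 hg))
      simp only [Set.mem_iUnion] at hg'
      obtain ⟨p, hpT, hp⟩ := hg'
      calc ‖f g‖ₑ ≤ ENNReal.ofReal C := by
            rw [← ofReal_norm]; exact ENNReal.ofReal_le_ofReal (hC g)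
        _ = Set.indicator (Z p.1.1 p.1.2) (fun _ => ENNReal.ofReal C) g := by
            rw [Set.indicator_of_mem hp]
        _ ≤ _ := Finset.single_le_sum
            (f := fun p : {p : Λ × Λ // s p.1 = s p.2} =>
              Set.indicator (Z p.1.1 p.1.2) (fun _ => ENNReal.ofReal C) g)
            (fun _ _ => zero_le) hpT
  have key : ∀ S : Set (PathGroupoid Λ),
      (∀ p : Λ × Λ, ∀ g ∈ S, ∀ h ∈ S, g ∈ Z p.1 p.2 → h ∈ Z p.1 p.2 → g = h) →
      ∑' g : S, ‖f g.1‖ₑ ≤ T.card * ENNReal.ofReal C := by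
    intro S hS
    calc ∑' g : S, ‖f g.1‖ₑ
        ≤ ∑' g : S, ∑ p ∈ T, Set.indicator (Z p.1.1 p.1.2) (fun _ => ENNReal.ofReal C) g.1 :=
          ENNReal.tsum_le_tsum fun g => hpt g.1
      _ = ∑ p ∈ T, ∑' g : S, Set.indicator (Z p.1.1 p.1.2) (fun _ => ENNReal.ofReal C) g.1 :=
          Summable.tsum_finsetSum fun _ _ => ENNReal.summable
      _ ≤ ∑ _p ∈ T, ENNReal.ofReal C := by
          refine Finset.sum_le_sum fun p _ => ?_
          by_cases hex : ∃ g : S, g.1 ∈ Z p.1.1 p.1.2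
          · obtain ⟨g, hg⟩ := hex
            rw [tsum_eq_single g]
            · exact Set.indicator_le_self _ _ _
            · intro h hne
              refine Set.indicator_of_notMem (fun hh => hne ?_) _
              exact Subtype.ext (hS p.1 h.1 h.2 g.1 g.2 hh hg)
          · have : ∀ g : S, Set.indicator (Z p.1.1 p.1.2) (fun _ => ENNReal.ofReal C) g.1 = 0 :=
              fun g => Set.indicator_of_notMem (fun hg => hex ⟨g, hg⟩) _
            simp [this]
      _ = T.card * ENNReal.ofReal C := by simp
  refine ne_top_of_le_ne_top (b := (T.card : ℝ≥0∞) * ENNReal.ofReal C)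
    (ENNReal.mul_ne_top (by simp) (by simp)) (max_le (iSup_le fun x => ?_) (iSup_le fun x => ?_))
  · exact key {g | g.rng = x} fun p g hg h hh h1 h2 => eq_of_mem_Z_of_rng h1 h2 (hg.trans hh.symm)
  · exact key {g | g.src = x} fun p g hg h hh h1 h2 => eq_of_mem_Z_of_src h1 h2 (hg.trans hh.symm)

/-- The direct product of all bounded representations of `C_c(G_Λ, σ)`. -/
noncomputable def ofCcAux (σ : PathGroupoid Λ → PathGroupoid Λ → Circle)
    (f : C_c(PathGroupoid Λ, ℂ)) : lp (fun R : Rep σ => R.B) ∞ :=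
  ⟨fun R => R.L f, memℓp_infty ⟨(iNorm f).toReal, by
    rintro _ ⟨R, rfl⟩
    have h := ENNReal.toReal_mono (iNorm_ne_top f) (R.bounded f)
    rwa [toReal_enorm] at h⟩⟩

/-- The twisted groupoid C*-algebra `C*(G_Λ, σ)`: the completion of `C_c(G_Λ, σ)` in the norm
`‖f‖ = sup {‖L(f)‖ : L a bounded representation}`, realised as the C*-algebra generated by the image
of `C_c(G_Λ, σ)` under the direct product of all bounded representations. -/
noncomputable def GroupoidCStar (σ : PathGroupoid Λ → PathGroupoid Λ → Circle) :
    NonUnitalStarSubalgebra ℂ (lp (fun R : Rep σ => R.B) ∞) :=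
  (NonUnitalStarAlgebra.adjoin ℂ (Set.range (ofCcAux σ))).topologicalClosure

noncomputable instance (σ : PathGroupoid Λ → PathGroupoid Λ → Circle) :
    NonUnitalCStarAlgebra (GroupoidCStar σ) :=
  NonUnitalStarSubalgebra.nonUnitalCStarAlgebra _
    (h_closed := NonUnitalStarSubalgebra.isClosed_topologicalClosure _)

/-- The canonical map from `C_c(G_Λ, σ)` to `C*(G_Λ, σ)`. -/
noncomputable def ofCc (σ : PathGroupoid Λ → PathGroupoid Λ → Circle)
    (f : C_c(PathGroupoid Λ, ℂ)) : GroupoidCStar σ :=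
  ⟨ofCcAux σ f, NonUnitalStarSubalgebra.le_topologicalClosure _
    (NonUnitalStarAlgebra.subset_adjoin ℂ _ (Set.mem_range_self f))⟩

end PathGroupoid

end KGraph

/-! Existence of the homomorphism. `TwistedCStar c` sits in the product over all Cuntz-Krieger
families and `GroupoidCStar` in the product over all bounded representations `L` of `C_c`. It
therefore suffices that the elements `L(1_{Z(λ,s(λ))})` form a Cuntz-Krieger family for each `L`
(`Rep.isCKFamily`): the homomorphism then merely reindexes coordinates (`prodHom`).

The relations are computed by convolution. Each `Z(μ,ν)` is a bisection, so a convolution of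
functions supported on such sets has at most one nonzero term, and everything reduces to values of
`σ_c`. As `(λ,s(λ)) ∈ P`, `σ_c` equals `c(μ,ν)` on composable pairs from `Z(μ,s(μ))` and `Z(ν,s(ν))`
(`twist_of_mem`). For `s_μ s_ν^*` the relevant number is `σ_c(g,h)` times the inverse of
`σ_c(h⁻¹,h)`; the member of `P` containing `h` cancels, and what remains is constant on each
`Z(μτ,ντ)` lying inside one member of `P` (`twist_mul_inv_twist`). By compactness of `Z(μ,ν)` all
`τ` of one large degree have this property (`exists_subordinate`), which yields the formula for
`π(s_μ s_ν^*)`.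

Surjectivity. The range of a `*`-homomorphism is closed. It contains the indicators of all basic
sets that refine members of `P`, since these are unimodular multiples of images of `s_μ s_ν^*`. On
one bisection the `I`-norm is at most the supremum norm, so step functions approximate every
continuous function supported there, and `P` cuts a general element of `C_c` into finitely many such
pieces (`ofCcAux_mem`).

Nonvanishing of the generators needs no partition: a Cuntz-Krieger family of nonzero operators is
built on `ℓ²(Λ^∞ × ℤ^k)`. Formally `λ` sends the basis vector at `y` to `c(λ,y)` times the one at
`λy`, where `c(λ,y)` is an ultrafilter limit of `c(λ,y(0,n))`. Prefixing a path shifts `n`, and a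
limit along an ultrafilter is not shift invariant; the `ℤ^k` coordinate records the shift, so that
the cocycle identity passes to the limit (`phase_mul`). -/

namespace KGraph

/-! ### Initial segments and the construction of infinite paths -/

section Paths

variable {k : ℕ} {Λ : Type u} [KGraph k Λ]

theorem r_eq_self_and_s_eq_self {v : Λ} (hv : deg v = 0) : r v = v ∧ s v = v := by
  have h := InfPath.eq_of_comp_eq (a := r v) (b := v) (a' := v) (b' := s v)
    (s_r v) (r_s v).symm (by rw [deg_r, hv]) (by rw [deg_s, hv])
    (by rw [r_comp_self, self_comp_s])
  exact ⟨h.1, h.2.symm⟩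

theorem r_eq_self {v : Λ} (hv : deg v = 0) : r v = v := (r_eq_self_and_s_eq_self hv).1

theorem s_eq_self {v : Λ} (hv : deg v = 0) : s v = v := (r_eq_self_and_s_eq_self hv).2

/-- `a` is an initial segment of `b`. -/
def IsInitial (a b : Λ) : Prop := ∃ τ, s a = r τ ∧ comp a τ = b

namespace IsInitial

theorem comp {a τ : Λ} (h : s a = r τ) : IsInitial a (comp a τ) := ⟨τ, h, rfl⟩

theorem trans {a b c : Λ} : IsInitial a b → IsInitial b c → IsInitial a c := by
  rintro ⟨τ, h, rfl⟩ ⟨ρ, h', rfl⟩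
  rw [s_comp _ _ h] at h'
  exact ⟨KGraph.comp τ ρ, by rw [r_comp _ _ h', h], (comp_assoc _ _ _ h h').symm⟩

theorem exists_of_le {b : Λ} {n : Fin k → ℕ} (h : n ≤ deg b) : ∃ a, IsInitial a b ∧ deg a = n := by
  obtain ⟨p, ⟨h1, h2, -, h4⟩, -⟩ := factorisation b n (deg b - n) (add_tsub_cancel_of_le h).symm
  exact ⟨p.1, ⟨p.2, h1, h4⟩, h2⟩

theorem eq_of_deg {a a' b : Λ} (h : IsInitial a b) (h' : IsInitial a' b) (hd : deg a = deg a') :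
    a = a' := by
  obtain ⟨τ, h1, h2⟩ := h
  obtain ⟨τ', h1', h2'⟩ := h'
  have e : deg a + deg τ = deg a' + deg τ' := by
    rw [← deg_comp _ _ h1, ← deg_comp _ _ h1', h2, h2']
  rw [hd] at e
  exact (InfPath.eq_of_comp_eq h1 h1' hd (add_left_cancel e) (h2.trans h2'.symm)).1

theorem of_deg_le {a a' b : Λ} (h : IsInitial a b) (h' : IsInitial a' b) (hd : deg a ≤ deg a') :
    IsInitial a a' := by
  obtain ⟨a₁, h1, h2⟩ := exists_of_le hd
  rwa [h.eq_of_deg (h1.trans h') h2.symm]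

theorem r_eq {a b : Λ} : IsInitial a b → r b = r a := by
  rintro ⟨τ, h, rfl⟩
  exact r_comp _ _ h

end IsInitial

namespace InfPath

/-- The initial segment `x(0, n)`. -/
def init (x : InfPath Λ) (n : Fin k → ℕ) : Λ := x.seg 0 n zero_le

theorem deg_init (x : InfPath Λ) (n : Fin k → ℕ) : deg (x.init n) = n := by
  rw [init, deg_seg, tsub_zero]

theorem r_init (x : InfPath Λ) (n : Fin k → ℕ) : r (x.init n) = x.range := x.r_seg _ _ _

theorem s_init (x : InfPath Λ) (n : Fin k → ℕ) : s (x.init n) = (x.shift n).range := by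
  rw [init, s_seg]
  exact seg_congr _ (zero_add n).symm (zero_add n).symm _

theorem init_zero (x : InfPath Λ) : x.init 0 = x.range := rfl

theorem shift_init (x : InfPath Λ) (m n : Fin k → ℕ) :
    (x.shift m).init n = x.seg m (m + n) (le_add_of_nonneg_right zero_le) :=
  seg_congr _ (zero_add m) (add_comm n m) _

theorem s_init_eq_r (x : InfPath Λ) (m n : Fin k → ℕ) :
    s (x.init m) = r ((x.shift m).init n) := by
  rw [s_init, r_init]

theorem init_add (x : InfPath Λ) (m n : Fin k → ℕ) :
    x.init (m + n) = comp (x.init m) ((x.shift m).init n) := by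
  rw [shift_init, init, init, comp_seg]

theorem isInitial_init (x : InfPath Λ) {m n : Fin k → ℕ} (h : m ≤ n) :
    IsInitial (x.init m) (x.init n) := by
  obtain ⟨p, rfl⟩ := exists_add_of_le h
  rw [init_add]
  exact IsInitial.comp (s_init_eq_r _ _ _)

theorem shift_zero (x : InfPath Λ) : x.shift 0 = x := by
  ext m n h
  exact seg_congr _ (add_zero m) (add_zero n) _

theorem ext_init {x y : InfPath Λ} (h : ∀ n, x.init n = y.init n) : x = y := by
  ext m n hmn
  obtain ⟨p, rfl⟩ := exists_add_of_le hmn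
  have h1 := h (m + p)
  rw [init_add, init_add] at h1
  have h2 := (eq_of_comp_eq (s_init_eq_r _ _ _) (s_init_eq_r _ _ _)
    (by rw [deg_init, deg_init]) (by rw [deg_init, deg_init]) h1).2
  rwa [shift_init, shift_init] at h2

theorem init_add_eq_comp_iff {x : InfPath Λ} {μ ν : Λ} (h : s μ = r ν) :
    x.init (deg μ + deg ν) = comp μ ν ↔
      x.init (deg μ) = μ ∧ (x.shift (deg μ)).init (deg ν) = ν := by
  rw [init_add]
  constructor
  · intro e
    exact eq_of_comp_eq (s_init_eq_r _ _ _) h (deg_init _ _) (deg_init _ _) e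
  · rintro ⟨h1, h2⟩
    rw [h1, h2]

theorem isConcat_iff {μ : Λ} {x y : InfPath Λ} :
    IsConcat μ x y ↔ y.init (deg μ) = μ ∧ y.shift (deg μ) = x := Iff.rfl

theorem eq_of_shift_eq' {y y' : InfPath Λ} (n : Fin k → ℕ) (h0 : y.init n = y'.init n)
    (h : y.shift n = y'.shift n) : y = y' := eq_of_shift_eq n h0 h

/-- The segment from `m` to `n` has to be the factor `T` with `f n = (f m) T`; its composition law
follows by cancelling `f m`, which unique factorisation allows. -/
theorem exists_ofInit (f : (Fin k → ℕ) → Λ) (hd : ∀ n, deg (f n) = n)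
    (hf : ∀ m n, m ≤ n → IsInitial (f m) (f n)) :
    ∃ x : InfPath Λ, ∀ n, x.init n = f n := by
  choose T hT1 hT2 using hf
  have hs : ∀ m n h, s (T m n h) = s (f n) := fun m n h => by
    rw [← s_comp _ _ (hT1 m n h), hT2]
  have hdT : ∀ m n h, deg (T m n h) = n - m := fun m n h => by
    have := deg_comp _ _ (hT1 m n h)
    rw [hT2, hd, hd] at this
    exact eq_tsub_of_add_eq ((add_comm _ _).trans this.symm)
  have hself : ∀ m, T m m le_rfl = s (f m) := fun m => by
    have h0 : deg (T m m le_rfl) = 0 := by rw [hdT, tsub_self]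
    rw [hT1 m m le_rfl, r_eq_self h0]
  refine ⟨⟨T, ?_, ?_, ?_, hdT⟩, ?_⟩
  · intro m n h
    rw [hself, hT1 m n h]
  · intro m n h
    rw [hself, hs]
  · intro m n p h h'
    have hmn : s (T m n h) = r (T n p h') := by rw [hs, hT1]
    refine (eq_of_comp_eq (a := f m) (a' := f m) ?_ (hT1 m p _) rfl ?_ ?_).2
    · rw [r_comp _ _ hmn, hT1 m n h]
    · rw [deg_comp _ _ hmn, hdT, hdT, hdT, add_comm, tsub_add_tsub_cancel h' h]
    · rw [← comp_assoc _ _ _ (hT1 m n h) hmn, hT2, hT2, hT2]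
  · intro n
    have h0 : s (f 0) = f 0 := s_eq_self (hd 0)
    have h1 := hT2 0 n zero_le
    rwa [← h0, hT1 0 n zero_le, r_comp_self] at h1

theorem exists_isConcat {μ : Λ} {x : InfPath Λ} (h : x.range = s μ) :
    ∃ y : InfPath Λ, IsConcat μ x y := by
  have hc : ∀ n, s μ = r (x.init n) := fun n => by rw [r_init, h]
  have hdc : ∀ n, deg (comp μ (x.init n)) = deg μ + n := fun n => by
    rw [deg_comp _ _ (hc n), deg_init]
  have hcc : ∀ m n, m ≤ n → IsInitial (comp μ (x.init m)) (comp μ (x.init n)) := by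
    intro m n hmn
    obtain ⟨τ, h1, h2⟩ := x.isInitial_init hmn
    exact ⟨τ, by rw [s_comp _ _ (hc m), h1], by rw [comp_assoc _ _ _ (hc m) h1, h2]⟩
  -- The path `μx` is prescribed through its initial segments: the one of degree `n` is cut from `μ
  -- x(0,n)`, which is long enough.
  have hex : ∀ n, ∃ a, IsInitial a (comp μ (x.init n)) ∧ deg a = n := fun n =>
    IsInitial.exists_of_le (by rw [hdc]; exact le_add_of_nonneg_left zero_le)
  choose f hf1 hf2 using hex
  obtain ⟨y, hy⟩ := exists_ofInit f hf2 fun m n hmn =>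
    ((hf1 m).trans (hcc m n hmn)).of_deg_le (hf1 n) (by rwa [hf2, hf2])
  have key : ∀ n, y.init (deg μ + n) = comp μ (x.init n) := fun n => by
    refine IsInitial.eq_of_deg (b := comp μ (x.init (deg μ + n))) ?_ ?_ ?_
    · rw [hy]; exact hf1 _
    · exact hcc _ _ (le_add_of_nonneg_left zero_le)
    · rw [deg_init, hdc]
  have key' : ∀ n, y.init (deg μ) = μ ∧ (y.shift (deg μ)).init n = x.init n := fun n => by
    have := (init_add_eq_comp_iff (x := y) (hc n)).1 (by rw [deg_init, key])
    rwa [deg_init] at this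
  exact ⟨y, (key' 0).1, ext_init fun n => (key' n).2⟩

theorem init_eq_comp {x y : InfPath Λ} {μ : Λ} (h : IsConcat μ x y) (n : Fin k → ℕ) :
    y.init (deg μ + n) = comp μ (x.init n) := by
  rw [init_add, (isConcat_iff.1 h).1, (isConcat_iff.1 h).2]

theorem IsConcat.range_eq {x y : InfPath Λ} {μ : Λ} (h : IsConcat μ x y) : x.range = s μ := by
  rw [← (isConcat_iff.1 h).2, ← s_init, (isConcat_iff.1 h).1]

theorem IsConcat.range_eq' {x y : InfPath Λ} {μ : Λ} (h : IsConcat μ x y) : y.range = r μ := by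
  rw [← r_init y (deg μ), (isConcat_iff.1 h).1]

theorem IsConcat.unique {x y y' : InfPath Λ} {μ : Λ} (h : IsConcat μ x y) (h' : IsConcat μ x y') :
    y = y' :=
  eq_of_shift_eq (deg μ) (h.1.trans h'.1.symm) (h.2.trans h'.2.symm)

theorem isConcat_init (x : InfPath Λ) (n : Fin k → ℕ) : IsConcat (x.init n) (x.shift n) x := by
  rw [isConcat_iff, deg_init]
  exact ⟨rfl, rfl⟩

theorem isConcat_comp_iff {x z : InfPath Λ} {μ ν : Λ} (h : s μ = r ν) :
    IsConcat (comp μ ν) x z ↔ z.init (deg μ) = μ ∧ IsConcat ν x (z.shift (deg μ)) := by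
  rw [isConcat_iff, isConcat_iff, deg_comp _ _ h, init_add_eq_comp_iff h, ← shift_shift, and_assoc]

theorem isConcat_vertex {v : Λ} (hv : deg v = 0) {x : InfPath Λ} (hx : x.range = v) :
    IsConcat v x x := by
  rw [isConcat_iff, hv, init_zero, shift_zero]
  exact ⟨hx, rfl⟩

/-- In a row-finite graph without sources every vertex is the range of an infinite path. -/
theorem exists_range_eq (hfin : RowFinite Λ) (hsrc : NoSources Λ) {v : Λ} (hv : deg v = 0) :
    ∃ x : InfPath Λ, x.range = v := by
  classical
  choose g hg using fun n => hsrc v n hv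
  -- An ultrafilter replaces König's lemma: `v Λ^m` is finite, so one of its elements is an initial
  -- segment of `g n` for `ω`-almost all `n`. The choices for two degrees are compatible because two
  -- sets in `ω` meet.
  let ω : Ultrafilter (Fin k → ℕ) := Ultrafilter.of Filter.atTop
  have hω : (ω : Filter (Fin k → ℕ)) ≤ Filter.atTop := Ultrafilter.of_le _
  have hex : ∀ m, ∃ τ ∈ into v m, ∀ᶠ n in (ω : Filter (Fin k → ℕ)), IsInitial τ (g n) := by
    intro m
    rw [← Ultrafilter.eventually_exists_mem_iff (hfin v m hv)]
    filter_upwards [hω (Filter.mem_atTop m)] with n hn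
    obtain ⟨a, h1, h2⟩ := IsInitial.exists_of_le (b := g n) (n := m) (by rwa [(hg n).2])
    exact ⟨a, ⟨by rw [← h1.r_eq, (hg n).1], h2⟩, h1⟩
  choose f hf1 hf2 using hex
  obtain ⟨x, hx⟩ := exists_ofInit f (fun n => (hf1 n).2) fun m n hmn => by
    obtain ⟨p, hp1, hp2⟩ := ((hf2 m).and (hf2 n)).exists
    exact hp1.of_deg_le hp2 (by rwa [(hf1 m).2, (hf1 n).2])
  refine ⟨x, ?_⟩
  rw [← init_zero, hx, ← r_eq_self (hf1 0).2, (hf1 0).1]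

end InfPath

end Paths

/-! ### The basic sets `Z(μ, ν)`: refinement, closedness, compactness -/

namespace PathGroupoid

variable {k : ℕ} {Λ : Type u} [KGraph k Λ]

open InfPath

theorem IsTriple.mem_Z {μ ν : Λ} {x : InfPath Λ} {g : PathGroupoid Λ} (h : IsTriple μ ν x g) :
    g ∈ Z μ ν := ⟨x, h.1.range_eq, h⟩

theorem IsTriple.unique {μ ν : Λ} {x : InfPath Λ} {g h : PathGroupoid Λ} (hg : IsTriple μ ν x g)
    (hh : IsTriple μ ν x h) : g = h :=
  PathGroupoid.ext (hg.1.unique hh.1) (hg.2.1.trans hh.2.1.symm) (hg.2.2.unique hh.2.2)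

theorem exists_isTriple_of_mem {μ ν : Λ} {g : PathGroupoid Λ} (hg : g ∈ Z μ ν) :
    ∃ x, IsTriple μ ν x g := by
  obtain ⟨x, -, hx⟩ := hg
  exact ⟨x, hx⟩

theorem source_eq_of_mem_Z {μ ν : Λ} {g : PathGroupoid Λ} (hg : g ∈ Z μ ν) : s μ = s ν := by
  obtain ⟨x, hx⟩ := exists_isTriple_of_mem hg
  rw [← hx.1.range_eq, hx.2.2.range_eq]

theorem exists_isTriple {μ ν : Λ} {x : InfPath Λ} (hμ : x.range = s μ) (h : s μ = s ν) :
    ∃ g, IsTriple μ ν x g := by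
  obtain ⟨y, hy⟩ := exists_isConcat hμ
  obtain ⟨z, hz⟩ := exists_isConcat (hμ.trans h)
  exact ⟨⟨y, _, z, deg μ, deg ν, rfl, hy.2.trans hz.2.symm⟩, hy, rfl, hz⟩

theorem lag_comp {μ ν τ : Λ} (hμ : s μ = r τ) (hν : s ν = r τ) :
    (fun i => (deg (comp μ τ) i : ℤ) - (deg (comp ν τ) i : ℤ)) =
      fun i => (deg μ i : ℤ) - (deg ν i : ℤ) := by
  funext i
  rw [deg_comp _ _ hμ, deg_comp _ _ hν]
  simp

theorem isTriple_comp_iff {μ ν τ : Λ} {y : InfPath Λ} {g : PathGroupoid Λ} (hμ : s μ = r τ)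
    (hν : s ν = r τ) :
    IsTriple (comp μ τ) (comp ν τ) y g ↔ ∃ x, IsTriple μ ν x g ∧ IsConcat τ y x := by
  simp only [IsTriple, isConcat_comp_iff hμ, isConcat_comp_iff hν, lag_comp hμ hν]
  constructor
  · rintro ⟨⟨h1, h2⟩, h3, h4, h5⟩
    exact ⟨_, ⟨⟨h1, h2.unique h5⟩, h3, h4, rfl⟩, h5⟩
  · rintro ⟨x, ⟨⟨h1, rfl⟩, h3, h4, h5⟩, h6⟩
    exact ⟨⟨h1, h6⟩, h3, h4, h5 ▸ h6⟩

theorem IsTriple.comp_init {μ ν : Λ} {x : InfPath Λ} {g : PathGroupoid Λ} (h : IsTriple μ ν x g)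
    (n : Fin k → ℕ) : IsTriple (comp μ (x.init n)) (comp ν (x.init n)) (x.shift n) g :=
  (isTriple_comp_iff (by rw [r_init, h.1.range_eq]) (by rw [r_init, h.2.2.range_eq])).2
    ⟨x, h, isConcat_init x n⟩

theorem Z_comp_subset {μ ν τ : Λ} (hμ : s μ = r τ) (hν : s ν = r τ) :
    Z (comp μ τ) (comp ν τ) ⊆ Z μ ν := by
  intro g hg
  obtain ⟨y, hy⟩ := exists_isTriple_of_mem hg
  obtain ⟨x, hx, -⟩ := (isTriple_comp_iff hμ hν).1 hy
  exact hx.mem_Z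

theorem deg_add_deg_eq {a b a' b' : Λ} {g : PathGroupoid Λ} (h : g ∈ Z a b) (h' : g ∈ Z a' b') :
    deg a + deg b' = deg a' + deg b := by
  obtain ⟨x, hx⟩ := exists_isTriple_of_mem h
  obtain ⟨y, hy⟩ := exists_isTriple_of_mem h'
  have := hx.2.1.symm.trans hy.2.1
  funext i
  have := congrFun this i
  simp only [Pi.add_apply] at this ⊢
  omega

/-- Two basic sets containing `g` have a common refinement in every common degree. -/
theorem IsTriple.comp_init_eq {a b a' b' : Λ} {x x' : InfPath Λ} {g : PathGroupoid Λ}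
    (h : IsTriple a b x g) (h' : IsTriple a' b' x' g) {n n' : Fin k → ℕ}
    (hn : deg a + n = deg a' + n') :
    comp a (x.init n) = comp a' (x'.init n') ∧ comp b (x.init n) = comp b' (x'.init n') ∧
      x.shift n = x'.shift n' := by
  have hn' : deg b + n = deg b' + n' := by
    have := deg_add_deg_eq h.mem_Z h'.mem_Z
    funext i
    have h1 := congrFun this i
    have h2 := congrFun hn i
    simp only [Pi.add_apply] at h1 h2 ⊢
    omega
  refine ⟨?_, ?_, ?_⟩
  · rw [← init_eq_comp h.1, ← init_eq_comp h'.1, hn]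
  · rw [← init_eq_comp h.2.2, ← init_eq_comp h'.2.2, hn']
  · rw [← (isConcat_iff.1 h.1).2, ← (isConcat_iff.1 h'.1).2, shift_shift, shift_shift, hn]

/-- If `Z(a, b)` meets `Z(a', b')` and `a` is not longer than `a'`, then `(a', b')` extends
`(a, b)`. -/
theorem exists_comp_eq_of_mem {a b a' b' : Λ} {g : PathGroupoid Λ} (h : g ∈ Z a b)
    (h' : g ∈ Z a' b') (hd : deg a ≤ deg a') :
    ∃ τ, r τ = s a ∧ a' = comp a τ ∧ b' = comp b τ := by
  obtain ⟨x, hx⟩ := exists_isTriple_of_mem h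
  obtain ⟨y, hy⟩ := exists_isTriple_of_mem h'
  obtain ⟨n, hn⟩ := exists_add_of_le hd
  obtain ⟨h1, h2, -⟩ := hx.comp_init_eq hy (n := n) (n' := 0) (by rw [hn, add_zero])
  rw [init_zero, hy.1.range_eq, self_comp_s] at h1
  rw [init_zero, hy.2.2.range_eq, self_comp_s] at h2
  exact ⟨x.init n, by rw [r_init, hx.1.range_eq], h1.symm, h2.symm⟩

/-- The sets `Z(μτ, ντ)`, `d(τ) = n`, form a partition of `Z(μ, ν)`. -/
theorem Z_eq_iUnion {μ ν : Λ} (h : s μ = s ν) (n : Fin k → ℕ) :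
    Z μ ν = ⋃ τ ∈ into (s μ) n, Z (comp μ τ) (comp ν τ) := by
  ext g
  simp only [Set.mem_iUnion, exists_prop]
  constructor
  · intro hg
    obtain ⟨x, hx⟩ := exists_isTriple_of_mem hg
    exact ⟨x.init n, ⟨by rw [r_init, hx.1.range_eq], deg_init _ _⟩, (hx.comp_init n).mem_Z⟩
  · rintro ⟨τ, ⟨h1, -⟩, h2⟩
    exact Z_comp_subset h1.symm (by rw [h1, h]) h2

theorem eq_of_mem_Z_comp {μ ν τ τ' : Λ} (hτ : r τ = s μ) (hτ' : r τ' = s μ) (h : s μ = s ν)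
    (hd : deg τ = deg τ') {g : PathGroupoid Λ} (hg : g ∈ Z (comp μ τ) (comp ν τ))
    (hg' : g ∈ Z (comp μ τ') (comp ν τ')) : τ = τ' := by
  obtain ⟨y, hy⟩ := exists_isTriple_of_mem hg
  obtain ⟨z, hz⟩ := exists_isTriple_of_mem hg'
  obtain ⟨x, hx, hx1⟩ := (isTriple_comp_iff hτ.symm (by rw [hτ, h])).1 hy
  obtain ⟨x', hx', hx2⟩ := (isTriple_comp_iff hτ'.symm (by rw [hτ', h])).1 hz
  obtain rfl : x = x' := hx.1.2.symm.trans hx'.1.2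
  rw [← (isConcat_iff.1 hx1).1, ← (isConcat_iff.1 hx2).1, hd]

theorem pairwiseDisjoint_Z_comp {μ ν : Λ} (h : s μ = s ν) (n : Fin k → ℕ) :
    (into (s μ) n).PairwiseDisjoint fun τ => Z (comp μ τ) (comp ν τ) := by
  intro τ hτ τ' hτ' hne
  rw [Function.onFun, Set.disjoint_left]
  exact fun g hg hg' => hne (eq_of_mem_Z_comp hτ.1 hτ'.1 h (hτ.2.trans hτ'.2.symm) hg hg')

/-- Both pairs are extended along `g` until their first entries have degree `d(μ) + d(a)`; the
equality of lags then forces the second entries to agree as well. -/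
theorem exists_refinement {μ ν : Λ} {g : PathGroupoid Λ} (hg : g ∈ Z μ ν) {a b : Λ}
    (hab : g ∈ Z a b) :
    ∃ τ γ, r τ = s μ ∧ r γ = s a ∧ comp μ τ = comp a γ ∧ comp ν τ = comp b γ ∧
      g ∈ Z (comp μ τ) (comp ν τ) := by
  obtain ⟨x, hx⟩ := exists_isTriple_of_mem hg
  obtain ⟨y, hy⟩ := exists_isTriple_of_mem hab
  obtain ⟨h1, h2, -⟩ := hx.comp_init_eq hy (add_comm (deg μ) (deg a))
  exact ⟨_, _, by rw [r_init, hx.1.range_eq], by rw [r_init, hy.1.range_eq], h1, h2,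
    (hx.comp_init _).mem_Z⟩

theorem isClosed_Z {μ ν : Λ} : IsClosed (Z μ ν) := by
  rw [← isOpen_compl_iff, isOpen_iff_forall_mem_open]
  intro g hg
  obtain ⟨⟨a, b⟩, hab, hgab⟩ := exists_mem_Z g
  obtain ⟨x, hx⟩ := exists_isTriple_of_mem hgab
  have hr : r (x.init (deg μ)) = s a := by rw [r_init, hx.1.range_eq]
  -- The first entry of this neighbourhood of `g` has degree at least `d(μ)`, so if it met `Z(μ, ν)`
  -- it would be contained in it.
  refine ⟨Z (comp a (x.init (deg μ))) (comp b (x.init (deg μ))), ?_, isOpen_Z ?_,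
    (hx.comp_init _).mem_Z⟩
  · intro h hh hh'
    obtain ⟨τ, h1, h2, h3⟩ := exists_comp_eq_of_mem hh' hh
      (by rw [deg_comp _ _ hr.symm, deg_init]; exact le_add_of_nonneg_left zero_le)
    refine hg (Z_comp_subset (τ := τ) h1.symm ?_ (h2 ▸ h3 ▸ (hx.comp_init (deg μ)).mem_Z))
    rw [← source_eq_of_mem_Z hh', h1]
  · rw [s_comp _ _ hr.symm, s_comp _ _ (by rw [hr]; exact hab.symm)]

theorem isCompact_Z (hfin : RowFinite Λ) {μ ν : Λ} (h : s μ = s ν) : IsCompact (Z μ ν) := by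
  rw [isCompact_iff_ultrafilter_le_nhds']
  intro U hU
  -- In each degree the ultrafilter selects one of the finitely many pieces `Z(μτ, ντ)`. The
  -- selected `τ` cohere to an infinite path `x`, and the limit point is `(μx, d(μ) - d(ν), νx)`.
  have hex : ∀ n, ∃ τ ∈ into (s μ) n, Z (comp μ τ) (comp ν τ) ∈ U := fun n => by
    rw [← Ultrafilter.finite_biUnion_mem_iff (hfin (s μ) n (deg_s μ)), ← Z_eq_iUnion h n]
    exact hU
  choose f hf1 hf2 using hex
  have hμ : ∀ n, s μ = r (f n) := fun n => (hf1 n).1.symm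
  have hν : ∀ n, s ν = r (f n) := fun n => h.symm.trans (hμ n)
  obtain ⟨x, hx⟩ := exists_ofInit f (fun n => (hf1 n).2) fun m n hmn => by
    obtain ⟨g, hg1, hg2⟩ := U.nonempty_of_mem (Filter.inter_mem (hf2 m) (hf2 n))
    obtain ⟨y, hy⟩ := exists_isTriple_of_mem hg1
    obtain ⟨z, hz⟩ := exists_isTriple_of_mem hg2
    obtain ⟨x, hx, hx1⟩ := (isTriple_comp_iff (hμ m) (hν m)).1 hy
    obtain ⟨x', hx', hx2⟩ := (isTriple_comp_iff (hμ n) (hν n)).1 hz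
    obtain rfl : x = x' := hx.1.2.symm.trans hx'.1.2
    rw [← (isConcat_iff.1 hx1).1, ← (isConcat_iff.1 hx2).1]
    exact x.isInitial_init (by rwa [(hf1 m).2, (hf1 n).2])
  have hxr : x.range = s μ := by
    rw [← r_init x 0, hx, ← hμ]
  obtain ⟨g, hg⟩ := exists_isTriple hxr h
  refine ⟨g, hg.mem_Z, ?_⟩
  rw [TopologicalSpace.nhds_generateFrom]
  refine le_iInf₂ fun S hS => ?_
  obtain ⟨hgS, a, b, hab, rfl⟩ := hS
  obtain ⟨y, hy⟩ := exists_isTriple_of_mem hgS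
  obtain ⟨h1, h2, -⟩ := hg.comp_init_eq hy (add_comm (deg μ) (deg a))
  rw [Filter.le_principal_iff]
  refine Filter.mem_of_superset (hf2 (deg a)) ?_
  rw [← hx, h1, h2]
  exact Z_comp_subset (by rw [r_init, hy.1.range_eq]) (by rw [r_init, hy.2.2.range_eq])

theorem nonempty_Z (hfin : RowFinite Λ) (hsrc : NoSources Λ) {μ ν : Λ} (h : s μ = s ν) :
    (Z μ ν).Nonempty := by
  obtain ⟨x, hx⟩ := exists_range_eq hfin hsrc (deg_s μ)
  obtain ⟨g, hg⟩ := exists_isTriple hx h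
  exact ⟨g, hg.mem_Z⟩

/-- A hereditary property which holds near each point of `Z(μ, ν)` holds uniformly. -/
theorem exists_forall_into (hfin : RowFinite Λ) (hsrc : NoSources Λ) {μ ν : Λ} (h : s μ = s ν)
    {Q : Λ → Prop} (hQ : ∀ τ δ, s τ = r δ → Q τ → Q (comp τ δ))
    (hex : ∀ g ∈ Z μ ν, ∃ τ, r τ = s μ ∧ Q τ ∧ g ∈ Z (comp μ τ) (comp ν τ)) :
    ∃ n, ∀ τ ∈ into (s μ) n, Q τ := by
  classical
  have hν : ∀ {τ : Λ}, r τ = s μ → s ν = r τ := fun hτ => by rw [hτ, h]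
  obtain ⟨T, hT⟩ := (isCompact_Z hfin h).elim_finite_subcover
    (fun τ : {τ : Λ // r τ = s μ ∧ Q τ} => Z (comp μ τ.1) (comp ν τ.1))
    (fun τ => isOpen_Z (by rw [s_comp _ _ τ.2.1.symm, s_comp _ _ (hν τ.2.1)]))
    (fun g hg => by
      obtain ⟨τ, h1, h2, h3⟩ := hex g hg
      exact Set.mem_iUnion.2 ⟨⟨τ, h1, h2⟩, h3⟩)
  -- The sum dominates the degree of every member of the subcover. A point of the nonempty set
  -- `Z(μτ, ντ)` lies in some `Z(μρ, νρ)` of the subcover, so `τ` extends `ρ` and inherits `Q`.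
  refine ⟨∑ τ ∈ T, deg τ.1, fun τ hτ => ?_⟩
  obtain ⟨g, hg⟩ := nonempty_Z hfin hsrc (μ := comp μ τ) (ν := comp ν τ)
    (by rw [s_comp _ _ hτ.1.symm, s_comp _ _ (hν hτ.1)])
  have := hT (Z_comp_subset hτ.1.symm (hν hτ.1) hg)
  simp only [Set.mem_iUnion] at this
  obtain ⟨ρ, hρT, hρ⟩ := this
  have hle : deg ρ.1 ≤ deg τ := by
    rw [hτ.2]
    exact Finset.single_le_sum (f := fun τ : {τ : Λ // r τ = s μ ∧ Q τ} => deg τ.1)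
      (fun _ _ => zero_le) hρT
  obtain ⟨δ, h1, h2, -⟩ := exists_comp_eq_of_mem hρ hg (by
    rw [deg_comp _ _ ρ.2.1.symm, deg_comp _ _ hτ.1.symm]
    gcongr)
  have hρδ : s ρ.1 = r δ := by rw [h1, s_comp _ _ ρ.2.1.symm]
  rw [comp_assoc _ _ _ ρ.2.1.symm hρδ] at h2
  have hd : deg τ = deg (comp ρ.1 δ) := by
    have := congrArg deg h2
    rw [deg_comp _ _ hτ.1.symm, deg_comp _ _ (by rw [r_comp _ _ hρδ, ρ.2.1])] at this
    exact add_left_cancel this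
  rw [(eq_of_comp_eq hτ.1.symm (by rw [r_comp _ _ hρδ, ρ.2.1]) rfl hd h2).2]
  exact hQ _ _ hρδ ρ.2.2

/-! ### Indicator functions and step functions in `C_c` -/

open Classical in
/-- The indicator function of `Z(μ, ν)`, for `s(μ) = s(ν)`. -/
noncomputable def one (hfin : RowFinite Λ) (μ ν : Λ) : C_c(PathGroupoid Λ, ℂ) :=
  if h : s μ = s ν then
    { toFun := Set.indicator (Z μ ν) fun _ => 1
      continuous_toFun := Continuous.indicator (by simp [IsClopen.frontier_eq ⟨isClosed_Z, isOpen_Z h⟩])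
        continuous_const
      hasCompactSupport' := HasCompactSupport.intro' (isCompact_Z hfin h) isClosed_Z
        fun _ hx => Set.indicator_of_notMem hx _ }
  else 0

theorem coe_one (hfin : RowFinite Λ) {μ ν : Λ} (h : s μ = s ν) :
    ⇑(one hfin μ ν) = Set.indicator (Z μ ν) fun _ => (1 : ℂ) := by
  rw [one, dif_pos h]; rfl

theorem one_apply_of_mem (hfin : RowFinite Λ) {μ ν : Λ} {g : PathGroupoid Λ} (hg : g ∈ Z μ ν) :
    one hfin μ ν g = 1 := by
  rw [coe_one hfin (source_eq_of_mem_Z hg), Set.indicator_of_mem hg]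

theorem one_apply_of_notMem (hfin : RowFinite Λ) {μ ν : Λ} {g : PathGroupoid Λ}
    (hg : g ∉ Z μ ν) : one hfin μ ν g = 0 := by
  by_cases h : s μ = s ν
  · rw [coe_one hfin h, Set.indicator_of_notMem hg]
  · rw [one, dif_neg h]; rfl

/-- The step function with value `a τ` on `Z(μτ, ντ)`, for `d(τ) = n`. -/
noncomputable def step (hfin : RowFinite Λ) (μ ν : Λ) (n : Fin k → ℕ) (a : Λ → ℂ) :
    C_c(PathGroupoid Λ, ℂ) :=
  ∑ τ ∈ (hfin (s μ) n (deg_s μ)).toFinset, a τ • one hfin (comp μ τ) (comp ν τ)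

theorem step_apply (hfin : RowFinite Λ) (μ ν : Λ) (n : Fin k → ℕ) (a : Λ → ℂ)
    (g : PathGroupoid Λ) : step hfin μ ν n a g =
      ∑ τ ∈ (hfin (s μ) n (deg_s μ)).toFinset, a τ * one hfin (comp μ τ) (comp ν τ) g := by
  rw [step, CompactlySupportedContinuousMap.sum_apply]
  rfl

theorem step_apply_of_mem (hfin : RowFinite Λ) {μ ν : Λ} (h : s μ = s ν) {n : Fin k → ℕ}
    (a : Λ → ℂ) {τ : Λ} (hτ : τ ∈ into (s μ) n) {g : PathGroupoid Λ}
    (hg : g ∈ Z (comp μ τ) (comp ν τ)) : step hfin μ ν n a g = a τ := by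
  rw [step_apply, Finset.sum_eq_single τ, one_apply_of_mem hfin hg, mul_one]
  · intro ρ hρ hne
    have hρ := (Set.Finite.mem_toFinset _).1 hρ
    rw [one_apply_of_notMem, mul_zero]
    exact fun hg' => hne (eq_of_mem_Z_comp hρ.1 hτ.1 h (hρ.2.trans hτ.2.symm) hg' hg)
  · exact fun hn => absurd ((Set.Finite.mem_toFinset _).2 hτ) hn

theorem step_apply_of_notMem (hfin : RowFinite Λ) {μ ν : Λ} (h : s μ = s ν) (n : Fin k → ℕ)
    (a : Λ → ℂ) {g : PathGroupoid Λ} (hg : g ∉ Z μ ν) : step hfin μ ν n a g = 0 := by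
  rw [step_apply]
  refine Finset.sum_eq_zero fun τ hτ => ?_
  have hτ := (Set.Finite.mem_toFinset _).1 hτ
  rw [one_apply_of_notMem, mul_zero]
  exact fun hg' => hg (Z_comp_subset hτ.1.symm (by rw [hτ.1, h]) hg')

theorem eq_step (hfin : RowFinite Λ) {μ ν : Λ} (h : s μ = s ν) (n : Fin k → ℕ) (a : Λ → ℂ)
    {f : PathGroupoid Λ → ℂ}
    (h1 : ∀ τ ∈ into (s μ) n, ∀ g ∈ Z (comp μ τ) (comp ν τ), f g = a τ)
    (h2 : ∀ g ∉ Z μ ν, f g = 0) : ⇑(step hfin μ ν n a) = f := by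
  funext g
  by_cases hg : g ∈ Z μ ν
  · have hg' := hg
    rw [Z_eq_iUnion h n] at hg'
    simp only [Set.mem_iUnion, exists_prop] at hg'
    obtain ⟨τ, hτ, hgτ⟩ := hg'
    rw [step_apply_of_mem hfin h a hτ hgτ, h1 τ hτ g hgτ]
  · rw [step_apply_of_notMem hfin h n a hg, h2 g hg]

/-! ### Values of the groupoid cocycle -/

theorem IsTriple.mul {a b d : Λ} {y : InfPath Λ} {g h : PathGroupoid Λ} (hg : IsTriple a b y g)
    (hh : IsTriple b d y h) (e : g.src = h.rng) : IsTriple a d y (g.mul h e) := by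
  refine ⟨hg.1, ?_, hh.2.2⟩
  change g.lag + h.lag = _
  rw [hg.2.1, hh.2.1]
  funext i
  simp

theorem IsTriple.inv {a b : Λ} {y : InfPath Λ} {g : PathGroupoid Λ} (hg : IsTriple a b y g) :
    IsTriple b a y g.inv := by
  refine ⟨hg.2.2, ?_, hg.1⟩
  change -g.lag = _
  rw [hg.2.1]
  funext i
  simp

theorem IsTriple.src_eq {a v : Λ} {y : InfPath Λ} {g : PathGroupoid Λ} (hg : IsTriple a v y g)
    (hv : deg v = 0) : g.src = y := by
  have := hg.2.2.2
  rwa [hv, shift_zero] at this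

theorem IsTriple.rng_eq {v b : Λ} {y : InfPath Λ} {g : PathGroupoid Λ} (hg : IsTriple v b y g)
    (hv : deg v = 0) : g.rng = y := by
  have := hg.1.2
  rwa [hv, shift_zero] at this

theorem inv_inv (g : PathGroupoid Λ) : g.inv.inv = g :=
  PathGroupoid.ext rfl (neg_neg g.lag) rfl

/-- The circle-valued function `c(μ, α) c(ν, α)⁻¹`. -/
noncomputable def ratio (c : Λ → Λ → Circle) (μ ν α : Λ) : Circle := c μ α * (c ν α)⁻¹

theorem ratio_self (c : Λ → Λ → Circle) (μ α : Λ) : ratio c μ μ α = 1 := mul_inv_cancel _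

/-- The cocycle identity for `(μ, α, δ)` and for `(ν, α, δ)` involves the same factor `c(α, δ)`,
which cancels in the quotient. -/
theorem ratio_comp {c : Λ → Λ → Circle} (hc : IsTwoCocycle c) {μ ν α δ : Λ} (hμ : s μ = r α)
    (hν : s ν = r α) (hα : s α = r δ) :
    ratio c μ ν (comp α δ) = ratio c μ ν α * ratio c (comp μ α) (comp ν α) δ := by
  have h1 := hc.cocycle μ α δ hμ hα
  have h2 := hc.cocycle ν α δ hν hα
  have e1 : c μ (comp α δ) = (c α δ)⁻¹ * (c μ α * c (comp μ α) δ) := by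
    rw [h1, inv_mul_cancel_left]
  have e2 : c ν (comp α δ) = (c α δ)⁻¹ * (c ν α * c (comp ν α) δ) := by
    rw [h2, inv_mul_cancel_left]
  rw [ratio, ratio, ratio, e1, e2]
  refine Additive.ofMul.injective ?_
  simp only [ofMul_mul, ofMul_inv]
  abel

theorem ratio_source {c : Λ → Λ → Circle} (hc : IsTwoCocycle c) {μ τ : Λ} (h : s μ = r τ) :
    ratio c μ (s μ) τ = c μ τ := by
  rw [ratio, hc.normalised _ _ (by rw [s_s, h]) (Or.inl (deg_s μ)), inv_one, mul_one]

theorem comp_init_eq_of_isTriple {a b α α' : Λ} {y y' : InfPath Λ} {g : PathGroupoid Λ}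
    (hα : r α = s a) (hα' : r α' = s a) (h : IsTriple (comp a α) (comp b α) y g)
    (h' : IsTriple (comp a α') (comp b α') y' g) {n n' : Fin k → ℕ}
    (hn : deg (comp a α) + n = deg (comp a α') + n') :
    comp α (y.init n) = comp α' (y'.init n') := by
  have hy : s α = r (y.init n) := by rw [r_init, h.1.range_eq, s_comp _ _ hα.symm]
  have hy' : s α' = r (y'.init n') := by rw [r_init, h'.1.range_eq, s_comp _ _ hα'.symm]
  obtain ⟨h1, -, -⟩ := h.comp_init_eq h' hn
  rw [comp_assoc _ _ _ hα.symm hy, comp_assoc _ _ _ hα'.symm hy'] at h1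
  refine (eq_of_comp_eq (by rw [r_comp _ _ hy, hα]) (by rw [r_comp _ _ hy', hα']) rfl ?_ h1).2
  rw [deg_comp _ _ hα.symm, deg_comp _ _ hα'.symm, add_assoc, add_assoc] at hn
  rw [deg_comp _ _ hy, deg_comp _ _ hy', deg_init, deg_init]
  exact add_left_cancel hn

theorem IsPartition.unique {P : Set (Λ × Λ)} (hP : IsPartition P) {g : PathGroupoid Λ}
    {p q : Λ × Λ} (hp : p ∈ P ∧ g ∈ Z p.1 p.2) (hq : q ∈ P ∧ g ∈ Z q.1 q.2) : p = q :=
  (hP.existsUnique g).unique hp hq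

/-- Lengthening `α`, `β`, `γ` by a common path does not change the value, and two choices of these
data agree after lengthening to a common degree. -/
theorem IsCocycleValue.unique {P : Set (Λ × Λ)} (hP : IsPartition P) {c : Λ → Λ → Circle}
    (hc : IsTwoCocycle c) {g h : PathGroupoid Λ} {z z' : Circle} (hz : IsCocycleValue P c g h z)
    (hz' : IsCocycleValue P c g h z') : z = z' := by
  obtain ⟨e, p, q, w, α, β, γ, y, hp, hq, hw, ⟨h1, h2, h3⟩, ⟨h4, h5, h6⟩, ⟨h7, h8, h9⟩, tg, th,
    tgh, rfl⟩ := hz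
  obtain ⟨e', p', q', w', α', β', γ', y', hp', hq', hw', ⟨h1', h2', h3'⟩, ⟨h4', h5', h6'⟩,
    ⟨h7', h8', h9'⟩, tg', th', tgh', rfl⟩ := hz'
  obtain rfl := hP.unique hp hp'
  obtain rfl := hP.unique hq hq'
  obtain rfl := hP.unique hw hw'
  have sp := hP.source_eq p hp.1
  have sq := hP.source_eq q hq.1
  have sw := hP.source_eq w hw.1
  -- The first choice is lengthened by degree `d(α')` and the second by `d(α)`; because of the
  -- relations between the three products, this equalises the degrees for `β` and `γ` too.
  have hd1 : deg (comp p.1 α) + deg α' = deg (comp p.1 α') + deg α := by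
    rw [deg_comp _ _ h1.symm, deg_comp _ _ h1'.symm, add_right_comm]
  have hd2 : deg (comp q.1 β) + deg α' = deg (comp q.1 β') + deg α := by
    rw [← h9, ← h9', deg_comp _ _ (by rw [h1, sp]), deg_comp _ _ (by rw [h1', sp]),
      add_right_comm]
  have hd3 : deg (comp w.1 γ) + deg α' = deg (comp w.1 γ') + deg α := by
    rw [← h7, ← h7', hd1]
  have eα := comp_init_eq_of_isTriple h1 h1' tg tg' hd1
  have eβ := comp_init_eq_of_isTriple h2 h2' th th' hd2
  have eγ := comp_init_eq_of_isTriple h3 h3' tgh tgh' hd3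
  -- By `ratio_comp` the lengthening multiplies in three further ratios, for the pairs `(μ_g α, ν_g
  -- α)`, `(μ_h β, ν_h β)` and, inverted, `(μ_{gh} γ, ν_{gh} γ)`. Their product telescopes to `1`.
  have key : ∀ {α β γ : Λ} {y : InfPath Λ} (n : Fin k → ℕ), r α = s p.1 → r β = s q.1 →
      r γ = s w.1 → s α = y.range → s β = y.range → s γ = y.range → comp p.1 α = comp w.1 γ →
      comp q.2 β = comp w.2 γ → comp p.2 α = comp q.1 β →
      c p.1 α * (c p.2 α)⁻¹ * (c q.1 β * (c q.2 β)⁻¹) * (c w.1 γ * (c w.2 γ)⁻¹)⁻¹ =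
        ratio c p.1 p.2 (comp α (y.init n)) * ratio c q.1 q.2 (comp β (y.init n)) *
          (ratio c w.1 w.2 (comp γ (y.init n)))⁻¹ := by
    intro α β γ y n h1 h2 h3 h4 h5 h6 h7 h8 h9
    rw [ratio_comp hc h1.symm (by rw [h1, sp]) (by rw [r_init, h4]),
      ratio_comp hc h2.symm (by rw [h2, sq]) (by rw [r_init, h5]),
      ratio_comp hc h3.symm (by rw [h3, sw]) (by rw [r_init, h6]), h7, h8, h9]
    simp only [ratio]
    refine Additive.ofMul.injective ?_
    simp only [ofMul_mul, ofMul_inv]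
    abel
  rw [key (deg α') h1 h2 h3 h4 h5 h6 h7 h8 h9, key (deg α) h1' h2' h3' h4' h5' h6' h7' h8' h9',
    eα, eβ, eγ]

theorem twist_eq {P : Set (Λ × Λ)} (hP : IsPartition P) {c : Λ → Λ → Circle}
    (hc : IsTwoCocycle c) {g h : PathGroupoid Λ} (e : g.src = h.rng) {p q w : Λ × Λ} (hp : p ∈ P)
    (hq : q ∈ P) (hw : w ∈ P) {α β γ : Λ} {y : InfPath Λ} (hα : r α = s p.1) (hβ : r β = s q.1)
    (hγ : r γ = s w.1) (h1 : comp p.1 α = comp w.1 γ) (h2 : comp q.2 β = comp w.2 γ)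
    (h3 : comp p.2 α = comp q.1 β) (tg : IsTriple (comp p.1 α) (comp p.2 α) y g)
    (th : IsTriple (comp q.1 β) (comp q.2 β) y h) :
    twist P c g h = ratio c p.1 p.2 α * ratio c q.1 q.2 β * (ratio c w.1 w.2 γ)⁻¹ := by
  have sp := hP.source_eq p hp
  have sq := hP.source_eq q hq
  have sw := hP.source_eq w hw
  have tgh : IsTriple (comp w.1 γ) (comp w.2 γ) y (g.mul h e) := by
    rw [← h1, ← h2]
    rw [← h3] at th
    exact tg.mul th e
  have H : IsCocycleValue P c g h (ratio c p.1 p.2 α * ratio c q.1 q.2 β *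
      (ratio c w.1 w.2 γ)⁻¹) := by
    refine ⟨e, p, q, w, α, β, γ, y, ⟨hp, ?_⟩, ⟨hq, ?_⟩, ⟨hw, ?_⟩, ⟨hα, hβ, hγ⟩, ⟨?_, ?_, ?_⟩,
      ⟨h1, h2, h3⟩, tg, th, tgh, rfl⟩
    · exact Z_comp_subset hα.symm (by rw [hα, sp]) tg.mem_Z
    · exact Z_comp_subset hβ.symm (by rw [hβ, sq]) th.mem_Z
    · exact Z_comp_subset hγ.symm (by rw [hγ, sw]) tgh.mem_Z
    · rw [tg.1.range_eq, s_comp _ _ hα.symm]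
    · rw [th.1.range_eq, s_comp _ _ hβ.symm]
    · rw [tgh.1.range_eq, s_comp _ _ hγ.symm]
  have H' : ∃ z, IsCocycleValue P c g h z := ⟨_, H⟩
  rw [twist, dif_pos H']
  exact H'.choose_spec.unique hP hc H

section Evaluation

variable {P : Set (Λ × Λ)} (hP : IsPartition P) (hPs : ∀ l : Λ, (l, s l) ∈ P)
  {c : Λ → Λ → Circle} (hc : IsTwoCocycle c)

theorem vertex_mem_of_forall_mem (hPs : ∀ l : Λ, (l, s l) ∈ P) {v : Λ} (hv : deg v = 0) :
    (v, v) ∈ P := by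
  have := hPs v
  rwa [s_eq_self hv] at this

include hP hPs hc

theorem twist_of_mem {μ ν : Λ} {g h : PathGroupoid Λ} {x y : InfPath Λ}
    (hg : IsTriple μ (s μ) x g) (hh : IsTriple ν (s ν) y h) (e : g.src = h.rng) :
    twist P c g h = c μ ν := by
  have hx : IsConcat ν y x := by
    rw [← hg.src_eq (deg_s μ), e]
    exact hh.1
  have hμν : s μ = r ν := by rw [← hg.1.range_eq, hx.range_eq']
  -- The products `gh` lie in `Z(μν, s(μν))`, so all three pairs come from the required part of `P`,
  -- and normalisation removes every factor except `c(μ, ν)`.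
  rw [twist_eq hP hc e (hPs μ) (hPs ν) (hPs (comp μ ν)) (α := ν) (β := s ν) (γ := s ν) (y := y)
    hμν.symm (r_s ν) (by rw [r_s, s_comp _ _ hμν]) ?_ ?_ ?_ ?_ ?_]
  · simp only
    rw [ratio_source hc hμν, ratio_source hc (r_s ν).symm, ratio_source hc (by
      rw [r_s, s_comp _ _ hμν]), hc.normalised _ _ (r_s ν).symm (Or.inr (deg_s ν)),
      hc.normalised _ _ (by rw [r_s, s_comp _ _ hμν]) (Or.inr (deg_s ν))]
    simp
  · simp only
    rw [← s_comp _ _ hμν, self_comp_s]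
  · simp only
    rw [s_comp _ _ hμν]
  · simp only
    rw [self_comp_s, hμν, r_comp_self]
  · exact (isTriple_comp_iff hμν (by rw [s_s, hμν])).2 ⟨x, hg, hx⟩
  · refine (isTriple_comp_iff (r_s ν).symm (by rw [r_s, s_s])).2 ⟨y, hh, ?_⟩
    exact isConcat_vertex (deg_s ν) hh.1.range_eq

/-- The products `h⁻¹h` and `hh⁻¹` are units, and the member of `P` containing a unit is a pair `(v,
v)` with `v` a vertex, whose ratio is `1`. Only the contributions of `h⁻¹` and `h` remain, and they
are the same in both orders. -/
theorem twist_inv_mul {ν τ β : Λ} {q : Λ × Λ} (hτ : r τ = s ν) (hq : q ∈ P) (hβ : r β = s q.1)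
    (h1 : comp (s ν) τ = comp q.1 β) (h2 : comp ν τ = comp q.2 β) {h : PathGroupoid Λ}
    (hh : h ∈ Z (comp (s ν) τ) (comp ν τ)) :
    twist P c h.inv h = c ν τ * ratio c q.1 q.2 β ∧
      twist P c h h.inv = c ν τ * ratio c q.1 q.2 β := by
  obtain ⟨y, hy⟩ := exists_isTriple_of_mem hh
  have hτ' : comp (s ν) τ = τ := by rw [← hτ, r_comp_self]
  constructor
  · rw [twist_eq hP hc rfl (hPs ν) hq (vertex_mem_of_forall_mem hPs (deg_r ν)) (α := τ) (β := β)
      (γ := comp ν τ) (y := y) hτ hβ ?_ ?_ ?_ ?_ ?_ ?_]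
    · simp only
      rw [ratio_source hc hτ.symm, ratio_self, inv_one, mul_one]
    · simp only
      rw [r_comp _ _ hτ.symm, s_r]
    · simp only
      rw [← r_comp _ _ hτ.symm, r_comp_self]
    · simp only
      rw [← r_comp _ _ hτ.symm, r_comp_self, h2]
    · exact h1
    · exact hy.inv
    · rwa [← h1, ← h2]
  · rw [twist_eq hP hc rfl hq (hPs ν) (vertex_mem_of_forall_mem hPs (deg_s ν)) (α := β) (β := τ)
      (γ := τ) (y := y) hβ hτ ?_ ?_ ?_ ?_ ?_ ?_]
    · simp only
      rw [ratio_source hc hτ.symm, ratio_self, inv_one, mul_one, mul_comm]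
    · simp only
      rw [hτ, s_s]
    · exact h1.symm
    · rfl
    · exact h2.symm
    · rwa [← h1, ← h2]
    · exact hy.inv

/-- This is the coefficient in `s_μ s_ν^*`. The member `q` of `P` containing `h` contributes the
same ratio to both twists and cancels, so the result depends on `τ`, `w` and `γ` but not on the
point. -/
theorem twist_mul_inv_twist {μ ν τ γ : Λ} {w : Λ × Λ} {x : InfPath Λ} (hτ : r τ = s μ)
    (hw : w ∈ P) (hγ : r γ = s w.1) (h1 : comp μ τ = comp w.1 γ) (h2 : comp ν τ = comp w.2 γ)
    {g h : PathGroupoid Λ} (e : g.src = h.rng) (hg : IsTriple μ (s μ) x g)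
    (hh : IsTriple (s ν) ν x h) (hx : x.init (deg τ) = τ) :
    twist P c g h * (twist P c h.inv h)⁻¹ = ratio c μ ν τ * (ratio c w.1 w.2 γ)⁻¹ := by
  have hμν : s μ = s ν := by rw [← hg.1.range_eq, ← hh.2.2.range_eq]
  have sw := hP.source_eq w hw
  have hτν : s ν = r τ := by rw [hτ, hμν]
  have hτ' : comp (s ν) τ = τ := by rw [hτν, r_comp_self]
  have hxτ : IsConcat τ (x.shift (deg τ)) x := ⟨hx, rfl⟩
  have hhτ : h ∈ Z (comp (s ν) τ) (comp ν τ) :=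
    ((isTriple_comp_iff (by rw [s_s, hτν]) hτν).2 ⟨x, hh, hxτ⟩).mem_Z
  obtain ⟨q, ⟨hq, hhq⟩, -⟩ := hP.existsUnique h
  have sq := hP.source_eq q hq
  -- The set belonging to `τ` need not lie inside `q`, so `τ` is lengthened by `δ` for the
  -- computation; `ratio_comp` removes `δ` again at the end.
  obtain ⟨δ, β, hδ, hβ, e1, e2, hhδ⟩ := exists_refinement hhτ hhq
  rw [hτ'] at e1 hδ
  rw [hτ', comp_assoc _ _ _ hτν hδ.symm] at hhδ
  rw [comp_assoc _ _ _ hτν hδ.symm] at e2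
  have hτδ : r (comp τ δ) = s ν := by rw [r_comp _ _ hδ.symm, hτν]
  have hγδ : s γ = r δ := by
    rw [hδ, ← s_comp _ _ hγ.symm, ← h1, s_comp _ _ hτ.symm]
  have e3 : comp (s ν) (comp τ δ) = comp τ δ := by rw [← hτδ, r_comp_self]
  obtain ⟨y, hy⟩ := exists_isTriple_of_mem hhδ
  have hy' : IsTriple (comp (s ν) (comp τ δ)) (comp ν (comp τ δ)) y h := by rwa [e3]
  obtain ⟨x', hx1, hx2⟩ := (isTriple_comp_iff (by rw [s_s, hτδ]) hτδ.symm).1 hy'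
  obtain rfl : x = x' := hh.2.2.2.symm.trans hx1.2.2.2
  have hc1 : comp μ (comp τ δ) = comp w.1 (comp γ δ) := by
    rw [← comp_assoc _ _ _ hτ.symm hδ.symm, h1, comp_assoc _ _ _ hγ.symm hγδ]
  have hc2 : comp ν (comp τ δ) = comp w.2 (comp γ δ) := by
    rw [← comp_assoc _ _ _ hτν hδ.symm, h2, comp_assoc _ _ _ (by rw [hγ, sw]) hγδ]
  rw [twist_eq hP hc e (hPs μ) hq hw (α := comp τ δ) (β := β) (γ := comp γ δ) (y := y) ?_ hβ ?_
      hc1 ?_ ?_ ?_ ?_, (twist_inv_mul hP hPs hc hτδ hq hβ (by rw [e3, e1]) e2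
      (by rw [e3]; exact hhδ)).1]
  · simp only
    rw [ratio_source hc (by rw [hτδ, hμν]), ratio_comp hc hγ.symm (by rw [hγ, sw]) hγδ, ← h1,
      ← h2]
    have h3 := ratio_comp hc hτ.symm hτν hδ.symm
    have h4 : c μ (comp τ δ) = ratio c μ ν (comp τ δ) * c ν (comp τ δ) := by
      rw [ratio, inv_mul_cancel_right]
    rw [h4, h3]
    refine Additive.ofMul.injective ?_
    simp only [ofMul_mul, ofMul_inv]
    abel
  · simp only
    rw [hτδ, hμν]
  · rw [r_comp _ _ hγδ, hγ]
  · rw [← hc2, e2]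
  · simp only
    rw [hμν, e3, e1]
  · refine (isTriple_comp_iff (by rw [hτδ, hμν]) ?_).2 ⟨x, hg, hx2⟩
    simp only
    rw [s_s, hμν, hτδ]
  · rwa [← e1, ← e2]

end Evaluation

/-! ### Convolution on basic sets and the Cuntz-Krieger relations -/

theorem mul_mem_Z {a b d : Λ} {g h : PathGroupoid Λ} (hg : g ∈ Z a b) (hh : h ∈ Z b d)
    (e : g.src = h.rng) : g.mul h e ∈ Z a d := by
  obtain ⟨x, hx⟩ := exists_isTriple_of_mem hg
  obtain ⟨y, hy⟩ := exists_isTriple_of_mem hh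
  obtain rfl : x = y := by rw [← hx.2.2.2, ← hy.1.2, e]
  exact (hx.mul hy e).mem_Z

theorem exists_mul_eq {a b d : Λ} {y : InfPath Λ} {γ : PathGroupoid Λ} (hγ : IsTriple a d y γ)
    (hb : s a = s b) : ∃ (g h : PathGroupoid Λ) (e : g.src = h.rng),
      IsTriple a b y g ∧ IsTriple b d y h ∧ g.mul h e = γ := by
  obtain ⟨g, hg⟩ := exists_isTriple (ν := b) hγ.1.range_eq hb
  obtain ⟨h, hh⟩ := exists_isTriple (ν := d) (hγ.1.range_eq.trans hb)
    (by rw [← hb, ← hγ.1.range_eq, hγ.2.2.range_eq])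
  exact ⟨g, h, hg.2.2.unique hh.1, hg, hh, (hg.mul hh _).unique hγ⟩

theorem inv_mem_Z {a b : Λ} {g : PathGroupoid Λ} (hg : g ∈ Z a b) : g.inv ∈ Z b a := by
  obtain ⟨x, hx⟩ := exists_isTriple_of_mem hg
  exact hx.inv.mem_Z

/-- An element of `Z(a, b)` is determined by its range, so only one factorisation of the product has
its first factor in the support of `f`. -/
theorem conv_mul (σ : PathGroupoid Λ → PathGroupoid Λ → Circle) {f f' : PathGroupoid Λ → ℂ}
    {a b : Λ} (hf : ∀ g ∉ Z a b, f g = 0) {g h : PathGroupoid Λ} (hg : g ∈ Z a b)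
    (e : g.src = h.rng) : conv σ f f' (g.mul h e) = σ g h * f g * f' h := by
  rw [conv, finsum_eq_single _ ⟨(g, h), e, rfl⟩]
  rintro ⟨⟨g', h'⟩, e', he⟩ hne
  by_cases hg' : g' ∈ Z a b
  · refine absurd ?_ hne
    have he1 : (g'.mul h' e').rng = (g.mul h e).rng := by rw [← he]
    have he2 : g'.lag + h'.lag = g.lag + h.lag := congrArg PathGroupoid.lag he
    have he3 : (g'.mul h' e').src = (g.mul h e).src := by rw [← he]
    have h1 : g' = g := eq_of_mem_Z_of_rng hg' hg he1
    subst h1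
    have h2 : h' = h := PathGroupoid.ext (e'.symm.trans e) (add_left_cancel he2) he3
    subst h2
    rfl
  · simp only
    rw [hf g' hg']
    simp

theorem conv_eq_zero (σ : PathGroupoid Λ → PathGroupoid Λ → Circle) {f f' : PathGroupoid Λ → ℂ}
    {γ : PathGroupoid Λ} (h : ∀ g h e, g.mul h e = γ → f g ≠ 0 → f' h ≠ 0 → False) :
    conv σ f f' γ = 0 := by
  rw [conv]
  refine (finsum_congr ?_).trans finsum_zero
  rintro ⟨⟨g', h'⟩, e', he⟩
  simp only
  by_cases h1 : f g' = 0
  · simp [h1]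
  · by_cases h2 : f' h' = 0
    · simp [h2]
    · exact (h g' h' e' he h1 h2).elim

theorem mem_of_one_ne_zero {hfin : RowFinite Λ} {μ ν : Λ} {g : PathGroupoid Λ}
    (h : one hfin μ ν g ≠ 0) : g ∈ Z μ ν := by
  by_contra hg
  exact h (one_apply_of_notMem hfin hg)

section Family

variable (hfin : RowFinite Λ) (hsrc : NoSources Λ) {P : Set (Λ × Λ)} (hP : IsPartition P)
  (hPs : ∀ l : Λ, (l, s l) ∈ P) {c : Λ → Λ → Circle} (hc : IsTwoCocycle c)

theorem invol_one_of_mem (σ : PathGroupoid Λ → PathGroupoid Λ → Circle) {ν : Λ}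
    {h : PathGroupoid Λ} (hh : h ∈ Z (s ν) ν) :
    invol σ (one hfin ν (s ν)) h = ((σ h.inv h)⁻¹ : Circle) := by
  rw [invol, one_apply_of_mem hfin (inv_mem_Z hh), star_one, mul_one, Circle.coe_inv_eq_conj]
  rfl

theorem mem_of_invol_one_ne_zero {σ : PathGroupoid Λ → PathGroupoid Λ → Circle} {ν : Λ}
    {h : PathGroupoid Λ} (hh : invol σ (one hfin ν (s ν)) h ≠ 0) : h ∈ Z (s ν) ν := by
  have h1 : one hfin ν (s ν) h.inv ≠ 0 := fun h0 => hh (by rw [invol, h0, star_zero, mul_zero])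
  have := inv_mem_Z (mem_of_one_ne_zero h1)
  rwa [inv_inv] at this

theorem invol_one_of_notMem (σ : PathGroupoid Λ → PathGroupoid Λ → Circle) {ν : Λ}
    {h : PathGroupoid Λ} (hh : h ∉ Z (s ν) ν) : invol σ (one hfin ν (s ν)) h = 0 := by
  by_contra h0
  exact hh (mem_of_invol_one_ne_zero hfin h0)

include hP in
/-- Deep enough refinements of `Z(μ, ν)` are contained in members of the partition; moreover they
satisfy any hereditary property which holds near each point of `Z(μ, ν)`. -/
theorem exists_subordinate (hfin : RowFinite Λ) (hsrc : NoSources Λ) {μ ν : Λ} (h : s μ = s ν)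
    (Q : Λ → Prop) (hQ : ∀ τ δ, r τ = s μ → s τ = r δ → Q τ → Q (comp τ δ))
    (hex : ∀ g ∈ Z μ ν, ∃ τ, r τ = s μ ∧ Q τ ∧ g ∈ Z (comp μ τ) (comp ν τ)) :
    ∃ n, ∀ τ ∈ into (s μ) n, Q τ ∧ ∃ w ∈ P, ∃ γ, r γ = s w.1 ∧ comp μ τ = comp w.1 γ ∧
      comp ν τ = comp w.2 γ := by
  have hν : ∀ {τ : Λ}, r τ = s μ → s ν = r τ := fun hτ => by rw [hτ, h]
  -- The condition `r τ = s μ` is made part of the hereditary property, since `exists_forall_into`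
  -- asks for heredity without knowing the range of `τ`.
  suffices ∃ n, ∀ τ ∈ into (s μ) n, r τ = s μ ∧ Q τ ∧ ∃ w ∈ P, ∃ γ, r γ = s w.1 ∧
      comp μ τ = comp w.1 γ ∧ comp ν τ = comp w.2 γ by
    obtain ⟨n, hn⟩ := this
    exact ⟨n, fun τ hτ => (hn τ hτ).2⟩
  refine exists_forall_into hfin hsrc h ?_ ?_
  · rintro τ δ hδ ⟨hτ, hQτ, w, hw, γ, h1, h2, h3⟩
    have hγδ : s γ = r δ := by rw [← s_comp _ _ h1.symm, ← h2, s_comp _ _ hτ.symm, hδ]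
    refine ⟨by rw [r_comp _ _ hδ, hτ], hQ τ δ hτ hδ hQτ, w, hw, comp γ δ, ?_, ?_, ?_⟩
    · rw [r_comp _ _ hγδ, h1]
    · rw [← comp_assoc _ _ _ hτ.symm hδ, h2, comp_assoc _ _ _ h1.symm hγδ]
    · rw [← comp_assoc _ _ _ (hν hτ) hδ, h3,
        comp_assoc _ _ _ (by rw [h1, hP.source_eq w hw]) hγδ]
  · intro g hg
    obtain ⟨τ, hτ, hQτ, hgτ⟩ := hex g hg
    obtain ⟨w, ⟨hw, hgw⟩, -⟩ := hP.existsUnique g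
    obtain ⟨δ, γ, hδ, hγ, h1, h2, h3⟩ := exists_refinement hgτ hgw
    rw [s_comp _ _ hτ.symm] at hδ
    rw [comp_assoc _ _ _ hτ.symm hδ.symm] at h1 h3
    rw [comp_assoc _ _ _ (hν hτ) hδ.symm] at h2 h3
    have hr : r (comp τ δ) = s μ := by rw [r_comp _ _ hδ.symm, hτ]
    exact ⟨_, hr, ⟨hr, hQ τ δ hτ hδ.symm hQτ, w, hw, γ, hγ, h1, h2⟩, h3⟩

include hP in
theorem exists_subordinate' (hfin : RowFinite Λ) (hsrc : NoSources Λ) {μ ν : Λ} (h : s μ = s ν) :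
    ∃ n, ∀ τ ∈ into (s μ) n, ∃ w ∈ P, ∃ γ, r γ = s w.1 ∧ comp μ τ = comp w.1 γ ∧
      comp ν τ = comp w.2 γ := by
  obtain ⟨n, hn⟩ := exists_subordinate hP hfin hsrc h (fun _ => True) (fun _ _ _ _ _ => trivial)
    fun g hg => ⟨s μ, r_s μ, trivial, by rwa [self_comp_s, h, self_comp_s]⟩
  exact ⟨n, fun τ hτ => (hn τ hτ).2⟩

include hP hPs hc

theorem conv_one_one {μ ν : Λ} (h : s μ = r ν) :
    conv (twist P c) (one hfin μ (s μ)) (one hfin ν (s ν)) =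
      (c μ ν : ℂ) • ⇑(one hfin (comp μ ν) (s (comp μ ν))) := by
  have hν : comp (s μ) ν = ν := by rw [h, r_comp_self]
  have hν' : s (s μ) = r ν := by rw [s_s, h]
  funext γ
  rw [Pi.smul_apply, smul_eq_mul]
  by_cases hγ : γ ∈ Z (comp μ ν) (s (comp μ ν))
  · obtain ⟨y, hy⟩ := exists_isTriple_of_mem hγ
    obtain ⟨g, h', e, hg, hh, rfl⟩ := exists_mul_eq hy (s_comp _ _ h)
    rw [s_comp _ _ h] at hh
    have hg' : IsTriple (comp μ ν) (comp (s μ) ν) y g := by rwa [hν]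
    obtain ⟨x, hx, -⟩ := (isTriple_comp_iff h hν').1 hg'
    rw [conv_mul _ (fun g hg => one_apply_of_notMem hfin hg) hx.mem_Z,
      one_apply_of_mem hfin hx.mem_Z, one_apply_of_mem hfin hh.mem_Z, one_apply_of_mem hfin hγ,
      twist_of_mem hP hPs hc hx hh e]
    simp
  · rw [one_apply_of_notMem hfin hγ, mul_zero]
    refine conv_eq_zero _ fun g h' e hgh h1 h2 => hγ ?_
    obtain ⟨x, hx⟩ := exists_isTriple_of_mem (mem_of_one_ne_zero h1)
    obtain ⟨y, hy⟩ := exists_isTriple_of_mem (mem_of_one_ne_zero h2)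
    have hyx : IsConcat ν y x := by
      rw [← hx.src_eq (deg_s μ), e]
      exact hy.1
    have hg' := (isTriple_comp_iff h hν').2 ⟨x, hx, hyx⟩
    rw [hν] at hg'
    rw [← hgh, s_comp _ _ h]
    exact (hg'.mul hy e).mem_Z

omit hP hPs hc in
theorem conv_one_one_of_ne {v w : Λ} (hv : deg v = 0) (hw : deg w = 0) (h : v ≠ w) :
    conv (twist P c) (one hfin v (s v)) (one hfin w (s w)) = 0 := by
  funext γ
  refine conv_eq_zero _ fun g h' e hgh h1 h2 => h ?_
  obtain ⟨x, hx⟩ := exists_isTriple_of_mem (mem_of_one_ne_zero h1)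
  obtain ⟨y, hy⟩ := exists_isTriple_of_mem (mem_of_one_ne_zero h2)
  have := hx.src_eq (deg_s v)
  rw [e, hy.rng_eq hw] at this
  rw [← s_eq_self hv, ← s_eq_self hw, ← hx.1.range_eq, ← hy.1.range_eq, this]

-- `Rep.map_invol` applies only to adjoints that are elements of `C_c`. By `twist_inv_mul` this
-- adjoint is constant on the pieces of a fine enough partition of `Z(s(ν), ν)`, hence a step
-- function.
include hsrc in
theorem exists_coe_eq_invol_one (ν : Λ) :
    ∃ f : C_c(PathGroupoid Λ, ℂ), ⇑f = invol (twist P c) (one hfin ν (s ν)) := by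
  have hs : s (s ν) = s ν := s_s ν
  obtain ⟨n, hn⟩ := exists_subordinate' hP hfin hsrc hs
  choose! w hw γ hγ h1 h2 using hn
  refine ⟨_, eq_step hfin hs n
    (fun τ => ((c ν τ * ratio c (w τ).1 (w τ).2 (γ τ))⁻¹ : Circle)) ?_ ?_⟩
  · intro τ hτ g hg
    have hτ' : r τ = s ν := by rw [hτ.1, hs]
    rw [invol_one_of_mem hfin _ (Z_comp_subset (by rw [hτ', hs]) hτ'.symm hg),
      (twist_inv_mul hP hPs hc hτ' (hw τ hτ) (hγ τ hτ) (h1 τ hτ) (h2 τ hτ) hg).1]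
  · exact fun g hg => invol_one_of_notMem hfin _ hg

theorem twist_inv_comm {ν : Λ} {h : PathGroupoid Λ} (hh : h ∈ Z (s ν) ν) :
    twist P c h.inv h = twist P c h h.inv := by
  obtain ⟨w, ⟨hw, hhw⟩, -⟩ := hP.existsUnique h
  obtain ⟨τ, γ, hτ, hγ, h1, h2, h3⟩ := exists_refinement hh hhw
  rw [s_s] at hτ
  obtain ⟨e1, e2⟩ := twist_inv_mul hP hPs hc hτ hw hγ h1 h2 h3
  rw [e1, e2]

theorem conv_invol_one_one (μ : Λ) :
    conv (twist P c) (invol (twist P c) (one hfin μ (s μ))) (one hfin μ (s μ)) =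
      one hfin (s μ) (s (s μ)) := by
  rw [s_s]
  funext γ
  by_cases hγ : γ ∈ Z (s μ) (s μ)
  · obtain ⟨x, hx⟩ := exists_isTriple_of_mem hγ
    obtain ⟨g, h, e, hg, hh, rfl⟩ := exists_mul_eq hx (b := μ) (s_s μ)
    obtain rfl : g = h.inv := hg.unique hh.inv
    rw [conv_mul _ (fun g hg => invol_one_of_notMem hfin _ hg) hg.mem_Z,
      invol_one_of_mem hfin _ hg.mem_Z, one_apply_of_mem hfin hh.mem_Z,
      one_apply_of_mem hfin hγ, twist_inv_comm hP hPs hc hg.mem_Z, inv_inv, mul_one,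
      ← Circle.coe_mul, mul_inv_cancel, Circle.coe_one]
  · rw [one_apply_of_notMem hfin hγ]
    refine conv_eq_zero _ fun g h e hgh h1 h2 => hγ ?_
    rw [← hgh]
    exact mul_mem_Z (mem_of_invol_one_ne_zero hfin h1) (mem_of_one_ne_zero h2) e

omit hP hPs hc in
theorem conv_one_invol_of_notMem {σ : PathGroupoid Λ → PathGroupoid Λ → Circle} {μ ν : Λ}
    (h : s μ = s ν) {g : PathGroupoid Λ} (hg : g ∉ Z μ ν) :
    conv σ (one hfin μ (s μ)) (invol σ (one hfin ν (s ν))) g = 0 := by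
  refine conv_eq_zero _ fun a b e hab h1 h2 => hg ?_
  rw [← hab]
  refine mul_mem_Z (mem_of_one_ne_zero h1) ?_ e
  rw [h]
  exact mem_of_invol_one_ne_zero hfin h2

theorem conv_one_invol_of_mem {μ ν τ γ : Λ} {w : Λ × Λ} (h : s μ = s ν) (hτ : r τ = s μ)
    (hw : w ∈ P) (hγ : r γ = s w.1) (h1 : comp μ τ = comp w.1 γ) (h2 : comp ν τ = comp w.2 γ)
    {g : PathGroupoid Λ} (hg : g ∈ Z (comp μ τ) (comp ν τ)) :
    conv (twist P c) (one hfin μ (s μ)) (invol (twist P c) (one hfin ν (s ν))) g =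
      (ratio c μ ν τ * (ratio c w.1 w.2 γ)⁻¹ : Circle) := by
  obtain ⟨y, hy⟩ := exists_isTriple_of_mem hg
  obtain ⟨x, hx, hxτ⟩ := (isTriple_comp_iff hτ.symm (by rw [hτ, h])).1 hy
  obtain ⟨a, b, e, ha, hb, rfl⟩ := exists_mul_eq hx (b := s μ) (s_s μ).symm
  have hb' : IsTriple (s ν) ν x b := by rwa [← h]
  rw [conv_mul _ (fun g hg => one_apply_of_notMem hfin hg) ha.mem_Z,
    one_apply_of_mem hfin ha.mem_Z, mul_one, invol_one_of_mem hfin _ hb'.mem_Z, ← Circle.coe_mul,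
    twist_mul_inv_twist hP hPs hc hτ hw hγ h1 h2 e ha hb' hxτ.1]

theorem conv_one_invol_eq_step {μ ν : Λ} (h : s μ = s ν) {n : Fin k → ℕ} {w : Λ → Λ × Λ}
    {γ : Λ → Λ} (hw : ∀ τ ∈ into (s μ) n, w τ ∈ P) (hγ : ∀ τ ∈ into (s μ) n, r (γ τ) = s (w τ).1)
    (h1 : ∀ τ ∈ into (s μ) n, comp μ τ = comp (w τ).1 (γ τ))
    (h2 : ∀ τ ∈ into (s μ) n, comp ν τ = comp (w τ).2 (γ τ)) :
    ⇑(step hfin μ ν n fun τ =>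
      (ratio c μ ν τ * (ratio c (w τ).1 (w τ).2 (γ τ))⁻¹ : Circle)) =
      conv (twist P c) (one hfin μ (s μ)) (invol (twist P c) (one hfin ν (s ν))) :=
  eq_step hfin h n _
    (fun τ hτ _ hg => conv_one_invol_of_mem hfin hP hPs hc h hτ.1 (hw τ hτ) (hγ τ hτ) (h1 τ hτ)
      (h2 τ hτ) hg)
    fun _ hg => conv_one_invol_of_notMem hfin h hg

/-- If `Z(μ, ν)` already refines a member of `P`, no subdivision is needed. This case gives both the
sum relation for vertices and the indicators needed for surjectivity. -/
theorem conv_one_invol_eq_smul_one {μ ν γ : Λ} {w : Λ × Λ} (h : s μ = s ν) (hw : w ∈ P)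
    (hγ : r γ = s w.1) (h1 : μ = comp w.1 γ) (h2 : ν = comp w.2 γ) :
    conv (twist P c) (one hfin μ (s μ)) (invol (twist P c) (one hfin ν (s ν))) =
      (((ratio c w.1 w.2 γ)⁻¹ : Circle) : ℂ) • ⇑(one hfin μ ν) := by
  funext g
  rw [Pi.smul_apply, smul_eq_mul]
  by_cases hg : g ∈ Z μ ν
  · rw [one_apply_of_mem hfin hg, mul_one, conv_one_invol_of_mem hfin hP hPs hc h (τ := s μ)
      (r_s μ) hw hγ (by rw [self_comp_s, h1]) (by rw [h, self_comp_s, h2])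
      (by rwa [self_comp_s, h, self_comp_s])]
    rw [ratio, hc.normalised _ _ (r_s μ).symm (Or.inr (deg_s μ)),
      hc.normalised _ _ (by rw [r_s, h]) (Or.inr (deg_s μ)), inv_one, mul_one, one_mul]
  · rw [one_apply_of_notMem hfin hg, mul_zero, conv_one_invol_of_notMem hfin h hg]

section Rep

variable (R : Rep (twist P c))

include hsrc in
theorem Rep.L_mul_star {μ ν : Λ} {f : C_c(PathGroupoid Λ, ℂ)}
    (hf : ⇑f = conv (twist P c) (one hfin μ (s μ)) (invol (twist P c) (one hfin ν (s ν)))) :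
    R.L (one hfin μ (s μ)) * star (R.L (one hfin ν (s ν))) = R.L f := by
  obtain ⟨f', hf'⟩ := exists_coe_eq_invol_one hfin hsrc hP hPs hc ν
  rw [← R.map_invol _ f' hf', ← R.map_conv _ _ f]
  rw [hf', hf]

omit hP hPs hc in
theorem one_vertex_eq_sum {v : Λ} (hv : deg v = 0) (n : Fin k → ℕ) :
    one hfin v v = ∑ τ ∈ (hfin v n hv).toFinset, one hfin τ τ := by
  have hs := s_eq_self hv
  have h0 : step hfin v v n (fun _ => 1) = one hfin v v := by
    refine DFunLike.coe_injective (eq_step hfin rfl n _ ?_ ?_)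
    · intro τ hτ g hg
      exact one_apply_of_mem hfin (Z_comp_subset hτ.1.symm hτ.1.symm hg)
    · exact fun g hg => one_apply_of_notMem hfin hg
  rw [← h0, step]
  refine Finset.sum_congr ?_ fun τ hτ => ?_
  · ext; simp [hs]
  · have hτ := (Set.Finite.mem_toFinset _).1 hτ
    rw [one_smul, ← hτ.1, r_comp_self]

include hsrc in
theorem Rep.isCKFamily : IsCKFamily c fun μ => R.L (one hfin μ (s μ)) := by
  have ck2 : ∀ μ ν : Λ, s μ = r ν → R.L (one hfin μ (s μ)) * R.L (one hfin ν (s ν)) =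
      (c μ ν : ℂ) • R.L (one hfin (comp μ ν) (s (comp μ ν))) := by
    intro μ ν h
    rw [← map_smul, ← R.map_conv]
    rw [conv_one_one hfin hP hPs hc h]
    rfl
  have ck3 : ∀ μ : Λ, star (R.L (one hfin μ (s μ))) * R.L (one hfin μ (s μ)) =
      R.L (one hfin (s μ) (s (s μ))) := by
    intro μ
    obtain ⟨f, hf⟩ := exists_coe_eq_invol_one hfin hsrc hP hPs hc μ
    rw [← R.map_invol _ f hf, ← R.map_conv]
    rw [hf, conv_invol_one_one hfin hP hPs hc]
  refine ⟨?_, ?_, ck2, ck3, ?_⟩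
  · intro v hv
    refine ⟨?_, ?_⟩
    · have := ck2 v v (by rw [s_eq_self hv, r_eq_self hv])
      rwa [hc.normalised _ _ (by rw [s_eq_self hv, r_eq_self hv]) (Or.inl hv), Circle.coe_one,
        one_smul, show comp v v = v by nth_rw 1 [← r_eq_self hv]; exact r_comp_self v] at this
    · have := ck3 v
      rw [s_eq_self hv, s_eq_self hv] at this
      change star (R.L (one hfin v (s v))) = R.L (one hfin v (s v))
      rw [s_eq_self hv]
      nth_rw 1 [← this]
      rw [star_mul, star_star, this]
  · intro v w hv hw h
    rw [← R.map_conv _ _ 0, map_zero]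
    rw [conv_one_one_of_ne hfin hv hw h]
    rfl
  · intro v n hv
    rw [finsum_mem_eq_finite_toFinset_sum _ (hfin v n hv)]
    simp only [s_eq_self hv]
    rw [one_vertex_eq_sum hfin hv n, map_sum]
    refine Finset.sum_congr rfl fun τ _ => ?_
    refine (Rep.L_mul_star hfin hsrc hP hPs hc R ?_).symm
    -- The set `Z(τ, τ)` refines the member `(r(τ), r(τ))` of `P`, whose ratio is `1`, so `s_τ
    -- s_τ^*` goes to the indicator itself.
    rw [conv_one_invol_eq_smul_one hfin hP hPs hc rfl
      (vertex_mem_of_forall_mem hPs (deg_r τ)) (γ := τ) (s_r τ).symm (r_comp_self τ).symm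
      (r_comp_self τ).symm]
    simp only
    rw [ratio_self, inv_one, Circle.coe_one, one_smul]

end Rep

end Family

end PathGroupoid

open scoped CStarAlgebra

/-! ### Closed range of `*`-homomorphisms -/

section ClosedRange

variable {A B : Type*} [NonUnitalCStarAlgebra A] [NonUnitalCStarAlgebra B]

/-- The lift is `f(a)`, with `f` the truncation to `[-δ, δ]` and `δ = ‖φ(a)‖`: it has norm at most
`δ`, and `φ(f(a)) = f(φ(a)) = φ(a)` because `f` is the identity on the quasispectrum of `φ(a)`. -/
theorem exists_selfAdjoint_lift (φ : A →⋆ₙₐ[ℂ] B) {a : A} (ha : IsSelfAdjoint a) :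
    ∃ a', φ a' = φ a ∧ ‖a'‖ ≤ ‖φ a‖ := by
  have hφ : Continuous φ := map_continuous φ
  set δ := ‖φ a‖ with hδ
  have hδ0 : 0 ≤ δ := norm_nonneg _
  let f : ℝ → ℝ := fun t => max (-δ) (min δ t)
  have hf : Continuous f := by fun_prop
  have hf0 : f 0 = 0 := by simp [f, hδ0]
  refine ⟨cfcₙ f a, ?_, ?_⟩
  · have hmap := NonUnitalStarAlgHomClass.map_cfcₙ (R := ℝ) (S := ℂ) φ f a hf.continuousOn hf0
      hφ ha (ha.map φ)
    rw [hmap]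
    conv_rhs => rw [← cfcₙ_id' ℝ (φ a) (ha.map φ)]
    refine cfcₙ_congr fun t ht => ?_
    have h1 : ‖t‖ ≤ δ := 
      NonUnitalIsometricContinuousFunctionalCalculus.norm_quasispectrum_le _ ht (ha.map φ)
    rw [Real.norm_eq_abs, abs_le] at h1
    simp only [f]
    rw [min_eq_right h1.2, max_eq_right h1.1]
  · refine norm_cfcₙ_le fun t _ => ?_
    rw [Real.norm_eq_abs, abs_le]
    exact ⟨le_max_left _ _, max_le (by linarith) (min_le_left _ _)⟩

theorem exists_norm_le_lift (φ : A →⋆ₙₐ[ℂ] B) (a : A) :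
    ∃ a', φ a' = φ a ∧ ‖a'‖ ≤ 2 * ‖φ a‖ := by
  have hre : ∀ x : A, IsSelfAdjoint ((2⁻¹ : ℂ) • (x + star x)) := fun x => by
    rw [IsSelfAdjoint, star_smul, star_add, star_star, add_comm]
    simp
  have hnorm : ∀ x : A, ‖φ ((2⁻¹ : ℂ) • (x + star x))‖ ≤ ‖φ x‖ := fun x => by
    rw [map_smul, map_add, map_star, norm_smul]
    have := norm_add_le (φ x) (star (φ x))
    rw [norm_star] at this
    simp only [norm_inv, Complex.norm_ofNat]
    linarith
  obtain ⟨x, hx1, hx2⟩ := exists_selfAdjoint_lift φ (hre a)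
  obtain ⟨y, hy1, hy2⟩ := exists_selfAdjoint_lift φ (hre (Complex.I • a))
  -- With `Re(a) = (a + a*)/2` one has `a = Re(a) - i Re(ia)`; the constant `2` counts the two
  -- self-adjoint parts.
  refine ⟨x - Complex.I • y, ?_, ?_⟩
  · rw [map_sub, map_smul, hx1, hy1, ← map_smul, ← map_sub]
    congr 1
    rw [star_smul]
    simp only [smul_add, smul_smul]
    rw [sub_eq_iff_eq_add]
    have h1 : Complex.I * (2⁻¹ * Complex.I) = -2⁻¹ := by
      rw [mul_left_comm, Complex.I_mul_I]; ring
    have h2 : Complex.I * (2⁻¹ * star Complex.I) = 2⁻¹ := by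
      rw [Complex.star_def, Complex.conj_I, mul_left_comm, mul_neg, Complex.I_mul_I]; ring
    rw [h1, h2]
    module
  · have h3 : ‖φ (Complex.I • a)‖ = ‖φ a‖ := by rw [map_smul, norm_smul]; simp
    have h4 := (hx2.trans (hnorm a))
    have h5 := (hy2.trans (hnorm (Complex.I • a)))
    rw [h3] at h5
    calc ‖x - Complex.I • y‖ ≤ ‖x‖ + ‖Complex.I • y‖ := norm_sub_le _ _
      _ = ‖x‖ + ‖y‖ := by rw [norm_smul]; simp
      _ ≤ 2 * ‖φ a‖ := by linarith

/-- A `*`-homomorphism between C*-algebras has closed range. -/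
theorem isClosed_range_starHom (φ : A →⋆ₙₐ[ℂ] B) : IsClosed (Set.range φ) := by
  let f : NormedAddGroupHom A B :=
    { toFun := φ
      map_add' := map_add φ
      bound' := ⟨1, fun a => by
        rw [one_mul]; exact NonUnitalStarAlgHom.norm_apply_le φ a⟩ }
  have h : f.SurjectiveOnWith f.range 2 := by
    rintro _ ⟨a, rfl⟩
    exact exists_norm_le_lift φ a
  -- Norm-controlled lifts and completeness of `A` let a limit of images be lifted by summing a
  -- convergent series.
  have h' := controlled_closure_of_complete (ε := 1) (by norm_num) one_pos h
  refine isClosed_of_closure_subset fun b hb => ?_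
  have hb' : b ∈ f.range.topologicalClosure := by
    rw [← SetLike.mem_coe, AddSubgroup.topologicalClosure_coe]
    convert hb
    ext; rfl
  obtain ⟨a, ha, -⟩ := h' b hb'
  exact ⟨a, ha⟩

end ClosedRange

/-! ### The homomorphism onto the groupoid algebra -/

namespace PathGroupoid

variable {k : ℕ} {Λ : Type u} [KGraph k Λ]

/-- The topology is only declared as generated by the sets `Z(μ, ν)`. Common refinements show that
they form a basis, and that the small neighbourhoods of `g` can be taken among the refinements of
one given `Z(μ, ν)`. -/
theorem exists_Z_comp_subset_of_isOpen {U : Set (PathGroupoid Λ)} (hU : IsOpen U)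
    {g : PathGroupoid Λ} (hgU : g ∈ U) {μ ν : Λ} (hg : g ∈ Z μ ν) :
    ∃ τ, r τ = s μ ∧ g ∈ Z (comp μ τ) (comp ν τ) ∧ Z (comp μ τ) (comp ν τ) ⊆ U := by
  have hU' : TopologicalSpace.GenerateOpen {U | ∃ μ ν : Λ, s μ = s ν ∧ U = Z μ ν} U := hU
  clear hU
  induction hU' generalizing μ ν with
  | basic V hV =>
    obtain ⟨a, b, -, rfl⟩ := hV
    obtain ⟨τ, γ, hτ, hγ, h1, h2, h3⟩ := exists_refinement hg hgU
    refine ⟨τ, hτ, h3, ?_⟩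
    rw [h1, h2]
    exact Z_comp_subset hγ.symm (by rw [hγ, source_eq_of_mem_Z hgU])
  | univ =>
    refine ⟨s μ, r_s μ, ?_, Set.subset_univ _⟩
    rwa [self_comp_s, source_eq_of_mem_Z hg, self_comp_s]
  | inter V W _ _ ihV ihW =>
    have h := source_eq_of_mem_Z hg
    obtain ⟨τ, hτ, h1, h2⟩ := ihV hgU.1 hg
    obtain ⟨δ, hδ, h3, h4⟩ := ihW hgU.2 h1
    have h5 := Z_comp_subset (ν := comp ν τ) hδ.symm (by rw [hδ, source_eq_of_mem_Z h1])
    rw [s_comp _ _ hτ.symm] at hδ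
    rw [comp_assoc _ _ _ hτ.symm hδ.symm, comp_assoc _ _ _ (by rw [hτ, h]) hδ.symm] at h3 h4 h5
    exact ⟨comp τ δ, by rw [r_comp _ _ hδ.symm, hτ], h3, Set.subset_inter (h5.trans h2) h4⟩
  | sUnion S _ ih =>
    obtain ⟨V, hV, hgV⟩ := hgU
    obtain ⟨τ, hτ, h1, h2⟩ := ih V hV hgV hg
    exact ⟨τ, hτ, h1, h2.trans (Set.subset_sUnion_of_mem hV)⟩

/-- Since `Z(μ, ν)` is a bisection, each sum in the `I`-norm has at most one nonzero term. -/
theorem iNorm_le {μ ν : Λ} {f : PathGroupoid Λ → ℂ} {ε : ℝ≥0∞} (h1 : ∀ g, ‖f g‖ₑ ≤ ε)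
    (h2 : ∀ g ∉ Z μ ν, f g = 0) : iNorm f ≤ ε := by
  have key : ∀ S : Set (PathGroupoid Λ), (∀ g ∈ S, ∀ h ∈ S, g ∈ Z μ ν → h ∈ Z μ ν → g = h) →
      ∑' g : S, ‖f g.1‖ₑ ≤ ε := by
    intro S hS
    by_cases hex : ∃ g : S, g.1 ∈ Z μ ν
    · obtain ⟨g, hg⟩ := hex
      rw [tsum_eq_single g]
      · exact h1 _
      · intro h hne
        rw [h2 h.1 fun hh => hne (Subtype.ext (hS _ h.2 _ g.2 hh hg)), enorm_zero]
    · have : ∀ g : S, ‖f g.1‖ₑ = 0 := fun g => by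
        rw [h2 g.1 fun hg => hex ⟨g, hg⟩, enorm_zero]
      simp [this]
  refine max_le (iSup_le fun x => ?_) (iSup_le fun x => ?_)
  · exact key {g | g.rng = x} fun g hg h hh h1 h2 => eq_of_mem_Z_of_rng h1 h2 (hg.trans hh.symm)
  · exact key {g | g.src = x} fun g hg h hh h1 h2 => eq_of_mem_Z_of_src h1 h2 (hg.trans hh.symm)

/-- The linear map from `C_c(G_Λ)` to the product of all representations. -/
noncomputable def ofCcLinear (σ : PathGroupoid Λ → PathGroupoid Λ → Circle) :
    C_c(PathGroupoid Λ, ℂ) →ₗ[ℂ] lp (fun R : Rep σ => R.B) ∞ where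
  toFun := ofCcAux σ
  map_add' f g := lp.ext <| funext fun R => map_add R.L f g
  map_smul' z f := lp.ext <| funext fun R => map_smul R.L z f

theorem norm_ofCcAux_le (σ : PathGroupoid Λ → PathGroupoid Λ → Circle)
    (f : C_c(PathGroupoid Λ, ℂ)) {ε : ℝ} (hε : 0 ≤ ε) (h : iNorm f ≤ ENNReal.ofReal ε) :
    ‖ofCcAux σ f‖ ≤ ε := by
  refine lp.norm_le_of_forall_le hε fun R => ?_
  have := (R.bounded f).trans h
  rw [← ofReal_norm] at this
  exact (ENNReal.ofReal_le_ofReal_iff hε).1 this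

section Hom

variable (hfin : RowFinite Λ) (hsrc : NoSources Λ) {P : Set (Λ × Λ)} (hP : IsPartition P)
  (hPs : ∀ l : Λ, (l, s l) ∈ P) {c : Λ → Λ → Circle} (hc : IsTwoCocycle c)

/-- The family `L(1_{Z(μ, s(μ))})` belonging to a representation `L` of `C_c(G_Λ, σ_c)`. -/
noncomputable def Rep.toCKRep (R : Rep (twist P c)) : CKRep c where
  B := R.B
  t μ := R.L (one hfin μ (s μ))
  isCK := R.isCKFamily hfin hsrc hP hPs hc

/-- The homomorphism of products of C*-algebras which in the coordinate `R` is the evaluation at the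
Cuntz-Krieger family of `R`. -/
noncomputable def prodHom :
    lp (fun R : CKRep c => R.B) ∞ →⋆ₙₐ[ℂ] lp (fun R : Rep (twist P c) => R.B) ∞ where
  toFun a := ⟨fun R => a (R.toCKRep hfin hsrc hP hPs hc), memℓp_infty ⟨‖a‖, by
    rintro _ ⟨R, rfl⟩
    exact lp.norm_apply_le_norm ENNReal.top_ne_zero a _⟩⟩
  map_smul' _ _ := rfl
  map_zero' := rfl
  map_add' _ _ := rfl
  map_mul' _ _ := rfl
  map_star' _ := rfl

theorem prodHom_mem (a : lp (fun R : CKRep c => R.B) ∞) (ha : a ∈ TwistedCStar c) :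
    prodHom hfin hsrc hP hPs hc a ∈ GroupoidCStar (twist P c) := by
  have hcont : Continuous (prodHom hfin hsrc hP hPs hc) := map_continuous _
  have hcl : IsClosed ((GroupoidCStar (twist P c)).comap (prodHom hfin hsrc hP hPs hc) :
      Set (lp (fun R : CKRep c => R.B) ∞)) :=
    (NonUnitalStarSubalgebra.isClosed_topologicalClosure _).preimage hcont
  refine NonUnitalStarSubalgebra.topologicalClosure_minimal _ ?_ hcl ha
  refine NonUnitalStarAlgebra.adjoin_le ?_
  rintro _ ⟨μ, rfl⟩
  exact NonUnitalStarSubalgebra.le_topologicalClosure _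
    (NonUnitalStarAlgebra.subset_adjoin ℂ _ (Set.mem_range_self _))

/-- The homomorphism `C*(Λ, c) → C*(G_Λ, σ_c)`. -/
noncomputable def toGroupoid : TwistedCStar c →⋆ₙₐ[ℂ] GroupoidCStar (twist P c) where
  toFun a := ⟨prodHom hfin hsrc hP hPs hc a.1, prodHom_mem hfin hsrc hP hPs hc a.1 a.2⟩
  map_smul' _ _ := rfl
  map_zero' := rfl
  map_add' _ _ := rfl
  map_mul' _ _ := rfl
  map_star' _ := rfl

theorem toGroupoid_gen (μ : Λ) :
    toGroupoid hfin hsrc hP hPs hc (gen c μ) = ofCc (twist P c) (one hfin μ (s μ)) := rfl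

theorem toGroupoid_gen_mul_star {μ ν : Λ} {f : C_c(PathGroupoid Λ, ℂ)}
    (hf : ⇑f = conv (twist P c) (one hfin μ (s μ)) (invol (twist P c) (one hfin ν (s ν)))) :
    toGroupoid hfin hsrc hP hPs hc (gen c μ * star (gen c ν)) = ofCc (twist P c) f :=
  Subtype.ext <| lp.ext <| funext fun R => Rep.L_mul_star hfin hsrc hP hPs hc R hf

theorem ofCc_sum_smul (σ : PathGroupoid Λ → PathGroupoid Λ → Circle) {ι : Type*} (F : Finset ι)
    (a : ι → ℂ) (f : ι → C_c(PathGroupoid Λ, ℂ)) :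
    ofCc σ (∑ i ∈ F, a i • f i) = ∑ i ∈ F, a i • ofCc σ (f i) := by
  refine Subtype.ext ?_
  rw [AddSubmonoidClass.coe_finsetSum]
  refine (map_sum (ofCcLinear σ) _ _).trans (Finset.sum_congr rfl fun i _ => ?_)
  exact map_smul (ofCcLinear σ) _ _

/-- The range of `C*(Λ, c) → C*(G_Λ, σ_c)`, as a submodule of the product. -/
noncomputable def rangeSub :
    NonUnitalStarSubalgebra ℂ (lp (fun R : Rep (twist P c) => R.B) ∞) :=
  NonUnitalStarAlgHom.range
    ((prodHom hfin hsrc hP hPs hc).comp (NonUnitalStarSubalgebraClass.subtype (TwistedCStar c)))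

theorem isClosed_rangeSub :
    IsClosed (rangeSub hfin hsrc hP hPs hc : Set (lp (fun R : Rep (twist P c) => R.B) ∞)) := by
  rw [rangeSub, NonUnitalStarAlgHom.coe_range]
  exact isClosed_range_starHom _

theorem ofCcAux_one_mem {μ ν γ : Λ} {w : Λ × Λ} (h : s μ = s ν) (hw : w ∈ P)
    (hγ : r γ = s w.1) (h1 : μ = comp w.1 γ) (h2 : ν = comp w.2 γ) :
    ofCcAux (twist P c) (one hfin μ ν) ∈ rangeSub hfin hsrc hP hPs hc := by
  have hm : ofCcAux (twist P c) ((((ratio c w.1 w.2 γ)⁻¹ : Circle) : ℂ) • one hfin μ ν) ∈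
      rangeSub hfin hsrc hP hPs hc := by
    refine ⟨gen c μ * star (gen c ν), ?_⟩
    exact congrArg Subtype.val (toGroupoid_gen_mul_star hfin hsrc hP hPs hc
      (conv_one_invol_eq_smul_one hfin hP hPs hc h hw hγ h1 h2).symm)
  have e : one hfin μ ν = ((ratio c w.1 w.2 γ : Circle) : ℂ) •
      (((ratio c w.1 w.2 γ)⁻¹ : Circle) : ℂ) • one hfin μ ν := by
    rw [smul_smul, ← Circle.coe_mul, mul_inv_cancel, Circle.coe_one, one_smul]
  rw [e]
  rw [show ofCcAux (twist P c) (((ratio c w.1 w.2 γ : Circle) : ℂ) •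
      (((ratio c w.1 w.2 γ)⁻¹ : Circle) : ℂ) • one hfin μ ν) = _ from
    map_smul (ofCcLinear (twist P c)) _ _]
  exact SMulMemClass.smul_mem _ hm

/-- By compactness, in some degree `f` varies by less than `ε / 2` on each piece `Z(μτ, ντ)` and
each piece refines a member of `P`. Sampling `f` once per piece gives a step function in the range,
close to `f` in the `I`-norm. -/
theorem ofCcAux_mem_of_support {μ ν : Λ} (h : s μ = s ν) {f : C_c(PathGroupoid Λ, ℂ)}
    (hf : ∀ g ∉ Z μ ν, f g = 0) :
    ofCcAux (twist P c) f ∈ rangeSub hfin hsrc hP hPs hc := by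
  have hν : ∀ {τ : Λ}, r τ = s μ → s ν = r τ := fun hτ => by rw [hτ, h]
  refine (isClosed_rangeSub hfin hsrc hP hPs hc).closure_subset (Metric.mem_closure_iff.2 ?_)
  intro ε hε
  have hsub := exists_subordinate hP hfin hsrc h
    (fun τ => ∀ g ∈ Z (comp μ τ) (comp ν τ), ∀ g' ∈ Z (comp μ τ) (comp ν τ),
      dist (f g) (f g') < ε / 2) ?_ ?_
  · obtain ⟨n, hn⟩ := hsub
    choose! Q w hw γ hγ h1 h2 using hn
    have : Nonempty (PathGroupoid Λ) := (nonempty_Z hfin hsrc h).to_type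
    choose! g₀ hg₀ using fun τ (hτ : τ ∈ into (s μ) n) =>
      nonempty_Z hfin hsrc (μ := comp μ τ) (ν := comp ν τ)
        (by rw [s_comp _ _ hτ.1.symm, s_comp _ _ (hν hτ.1)])
    refine ⟨ofCcAux (twist P c) (step hfin μ ν n fun τ => f (g₀ τ)), ?_, ?_⟩
    · have : ofCcAux (twist P c) (step hfin μ ν n fun τ => f (g₀ τ)) =
          ∑ τ ∈ (hfin (s μ) n (deg_s μ)).toFinset,
            f (g₀ τ) • ofCcAux (twist P c) (one hfin (comp μ τ) (comp ν τ)) := by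
        refine (map_sum (ofCcLinear (twist P c)) _ _).trans (Finset.sum_congr rfl fun i _ => ?_)
        exact map_smul (ofCcLinear (twist P c)) _ _
      rw [this]
      refine sum_mem fun τ hτ => SMulMemClass.smul_mem _ ?_
      have hτ := (Set.Finite.mem_toFinset _).1 hτ
      exact ofCcAux_one_mem hfin hsrc hP hPs hc
        (by rw [s_comp _ _ hτ.1.symm, s_comp _ _ (hν hτ.1)]) (hw τ hτ) (hγ τ hτ) (h1 τ hτ)
        (h2 τ hτ)
    · rw [dist_eq_norm]
      refine lt_of_le_of_lt ?_ (half_lt_self hε)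
      rw [← show ofCcAux (twist P c) (f - step hfin μ ν n fun τ => f (g₀ τ)) =
          ofCcAux _ f - ofCcAux _ _ from map_sub (ofCcLinear (twist P c)) _ _]
      refine norm_ofCcAux_le _ _ (half_pos hε).le (iNorm_le (μ := μ) (ν := ν) ?_ ?_)
      · intro g
        rw [← ofReal_norm]
        refine ENNReal.ofReal_le_ofReal ?_
        rw [CompactlySupportedContinuousMap.sub_apply]
        by_cases hg : g ∈ Z μ ν
        · rw [Z_eq_iUnion h n] at hg
          simp only [Set.mem_iUnion, exists_prop] at hg
          obtain ⟨τ, hτ, hgτ⟩ := hg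
          rw [step_apply_of_mem hfin h _ hτ hgτ, ← dist_eq_norm]
          exact (Q τ hτ g hgτ _ (hg₀ τ hτ)).le
        · rw [hf g hg, step_apply_of_notMem hfin h _ _ hg, sub_zero, norm_zero]
          exact (half_pos hε).le
      · intro g hg
        rw [CompactlySupportedContinuousMap.sub_apply, hf g hg,
          step_apply_of_notMem hfin h _ _ hg, sub_zero]
  · intro τ δ hτ hδ hQ g hg g' hg'
    rw [← comp_assoc _ _ _ hτ.symm hδ, ← comp_assoc _ _ _ (hν hτ) hδ] at hg hg'
    have hsub := Z_comp_subset (μ := comp μ τ) (ν := comp ν τ) (τ := δ)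
      (by rw [s_comp _ _ hτ.symm, hδ]) (by rw [s_comp _ _ (hν hτ), hδ])
    exact hQ g (hsub hg) g' (hsub hg')
  · intro g hg
    have hU : IsOpen {g' | dist (f g') (f g) < ε / 4} :=
      isOpen_lt (f.continuous.dist continuous_const) continuous_const
    obtain ⟨τ, hτ, hgτ, hsub⟩ := exists_Z_comp_subset_of_isOpen hU
      (by rw [Set.mem_ofPred_eq, dist_self]; positivity) hg
    refine ⟨τ, hτ, fun a ha b hb => ?_, hgτ⟩
    have h1 : dist (f a) (f g) < ε / 4 := hsub ha
    have h2 : dist (f b) (f g) < ε / 4 := hsub hb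
    have h3 := dist_triangle_right (f a) (f b) (f g)
    linarith

theorem ofCcAux_mem (f : C_c(PathGroupoid Λ, ℂ)) :
    ofCcAux (twist P c) f ∈ rangeSub hfin hsrc hP hPs hc := by
  classical
  obtain ⟨T, hT⟩ := f.hasCompactSupport.isCompact.elim_finite_subcover
    (fun p : P => Z p.1.1 p.1.2) (fun p => isOpen_Z (hP.source_eq _ p.2))
    (fun g _ => by
      obtain ⟨p, ⟨hp, hg⟩, -⟩ := hP.existsUnique g
      exact Set.mem_iUnion.2 ⟨⟨p, hp⟩, hg⟩)
  -- Members of `P` give disjoint sets, so at each point where `f` is nonzero exactly one of these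
  -- indicators is `1`.
  have e : f = ∑ p ∈ T, f * one hfin p.1.1 p.1.2 := by
    ext g
    rw [CompactlySupportedContinuousMap.sum_apply]
    simp only [CompactlySupportedContinuousMap.mul_apply]
    rw [← Finset.mul_sum]
    by_cases hg : f g = 0
    · simp [hg]
    · have hg' := hT (subset_tsupport _ (Function.mem_support.2 hg))
      simp only [Set.mem_iUnion] at hg'
      obtain ⟨p, hpT, hp⟩ := hg'
      rw [Finset.sum_eq_single_of_mem p hpT, one_apply_of_mem hfin hp, mul_one]
      intro q _ hne
      refine one_apply_of_notMem hfin fun hq => hne (Subtype.ext ?_)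
      exact hP.unique ⟨q.2, hq⟩ ⟨p.2, hp⟩
  rw [e, show ofCcAux (twist P c) (∑ p ∈ T, f * one hfin p.1.1 p.1.2) = _ from
    map_sum (ofCcLinear (twist P c)) _ _]
  refine sum_mem fun p _ => ofCcAux_mem_of_support hfin hsrc hP hPs hc (hP.source_eq _ p.2) ?_
  intro g hg
  rw [CompactlySupportedContinuousMap.mul_apply, one_apply_of_notMem hfin hg, mul_zero]

theorem toGroupoid_surjective : Function.Surjective (toGroupoid hfin hsrc hP hPs hc) := by
  rintro ⟨b, hb⟩
  have hle : GroupoidCStar (twist P c) ≤ rangeSub hfin hsrc hP hPs hc := by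
    refine NonUnitalStarSubalgebra.topologicalClosure_minimal _ ?_
      (isClosed_rangeSub hfin hsrc hP hPs hc)
    refine NonUnitalStarAlgebra.adjoin_le ?_
    rintro _ ⟨f, rfl⟩
    exact ofCcAux_mem hfin hsrc hP hPs hc f
  obtain ⟨a, ha⟩ := hle hb
  exact ⟨a, Subtype.ext ha⟩

end Hom

end PathGroupoid

/-! ### Weighted composition operators and their adjoints -/

section WeightedComposition

variable {I : Type*}

/-- Weighted composition operators on `ℓ²`. -/
noncomputable def weightedComp (w : I → ℂ) (φ : I → I) (hw : ∀ i, ‖w i‖ ≤ 1)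
    (hφ : ∀ i j, w i ≠ 0 → w j ≠ 0 → φ i = φ j → i = j) :
    lp (fun _ : I => ℂ) 2 →L[ℂ] lp (fun _ : I => ℂ) 2 :=
  have h2 : 0 < (2 : ℝ≥0∞).toReal := by norm_num
  have key : ∀ (ξ : lp (fun _ : I => ℂ) 2) (F : Finset I),
      ∑ i ∈ F, ‖w i * ξ (φ i)‖ ^ (2 : ℝ≥0∞).toReal ≤ ‖ξ‖ ^ (2 : ℝ≥0∞).toReal := by
    classical
    intro ξ F
    -- Indices of weight zero are dropped; `φ` is injective on the others, so the sum is dominated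
    -- by a finite part of `‖ξ‖²`.
    rw [← Finset.sum_filter_of_ne (p := fun i => w i ≠ 0) (fun i _ hi h0 => hi (by
      rw [h0, zero_mul, norm_zero, Real.zero_rpow h2.ne']))]
    calc ∑ i ∈ F with w i ≠ 0, ‖w i * ξ (φ i)‖ ^ (2 : ℝ≥0∞).toReal
        ≤ ∑ i ∈ F with w i ≠ 0, ‖ξ (φ i)‖ ^ (2 : ℝ≥0∞).toReal := by
          refine Finset.sum_le_sum fun i _ => ?_
          refine Real.rpow_le_rpow (norm_nonneg _) ?_ h2.le
          rw [norm_mul]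
          exact mul_le_of_le_one_left (norm_nonneg _) (hw i)
      _ = ∑ j ∈ (F.filter fun i => w i ≠ 0).image φ, ‖ξ j‖ ^ (2 : ℝ≥0∞).toReal := by
          rw [Finset.sum_image]
          intro i hi j hj hij
          exact hφ i j (Finset.mem_filter.1 hi).2 (Finset.mem_filter.1 hj).2 hij
      _ ≤ _ := lp.sum_rpow_le_norm_rpow h2 ξ _
  LinearMap.mkContinuous
    { toFun := fun ξ => ⟨fun i => w i * ξ (φ i), memℓp_gen' (key ξ)⟩
      map_add' := fun ξ η => lp.ext <| funext fun i => mul_add (w i) (ξ (φ i)) (η (φ i))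
      map_smul' := fun z ξ => lp.ext <| funext fun i => mul_left_comm (w i) z (ξ (φ i)) }
    1 fun ξ => by
      rw [one_mul]
      exact lp.norm_le_of_forall_sum_le h2 (norm_nonneg _) (key ξ)

variable {w : I → ℂ} {φ : I → I} (hw : ∀ i, ‖w i‖ ≤ 1)
    (hφ : ∀ i j, w i ≠ 0 → w j ≠ 0 → φ i = φ j → i = j)

theorem weightedComp_apply (ξ : lp (fun _ : I => ℂ) 2) (i : I) :
    weightedComp w φ hw hφ ξ i = w i * ξ (φ i) := rfl

/-- The operator sends the basis vector at `φ i` to `w i` times the one at `i`, because no other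
index of nonzero weight has the same image. Pairing with `ξ` gives the adjoint. -/
theorem star_weightedComp_apply (ξ : lp (fun _ : I => ℂ) 2) {i : I} (hi : w i ≠ 0) :
    star (weightedComp w φ hw hφ) ξ (φ i) = star (w i) * ξ i := by
  classical
  have h1 := ContinuousLinearMap.adjoint_inner_right (weightedComp w φ hw hφ)
    (lp.single 2 (φ i) (1 : ℂ)) ξ
  have h2 : weightedComp w φ hw hφ (lp.single 2 (φ i) (1 : ℂ)) = lp.single 2 i (w i) := by
    refine lp.ext <| funext fun j => ?_
    rw [weightedComp_apply]
    by_cases hj : j = i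
    · subst hj
      rw [lp.single_apply_self, lp.single_apply_self, mul_one]
    · rw [lp.single_apply_ne _ _ _ hj]
      by_cases hwj : w j = 0
      · rw [hwj, zero_mul]
      · rw [lp.single_apply_ne _ _ _ fun h => hj (hφ _ _ hwj hi h), mul_zero]
  rw [h2, lp.inner_single_left, lp.inner_single_left, ← ContinuousLinearMap.star_eq_adjoint] at h1
  simp only [RCLike.inner_apply, map_one, mul_one] at h1
  rw [h1, mul_comm]
  rfl

theorem star_weightedComp_apply_eq_zero (ξ : lp (fun _ : I => ℂ) 2) {j : I}
    (hj : ∀ i, φ i = j → w i = 0) : star (weightedComp w φ hw hφ) ξ j = 0 := by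
  classical
  have h1 := ContinuousLinearMap.adjoint_inner_right (weightedComp w φ hw hφ)
    (lp.single 2 j (1 : ℂ)) ξ
  have h2 : weightedComp w φ hw hφ (lp.single 2 j (1 : ℂ)) = 0 := by
    refine lp.ext <| funext fun i => ?_
    rw [weightedComp_apply]
    by_cases hi : φ i = j
    · rw [hj i hi, zero_mul]
      rfl
    · rw [lp.single_apply_ne _ _ _ hi, mul_zero]
      rfl
  rw [h2, lp.inner_single_left, ← ContinuousLinearMap.star_eq_adjoint, inner_zero_left] at h1
  simpa using h1

end WeightedComposition

/-! ### A Cuntz-Krieger family of nonzero operators on `ℓ²(Λ^∞ × ℤ^k)` -/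

section PathRepresentation

variable {k : ℕ} {Λ : Type u} [KGraph k Λ]

open InfPath Filter Topology

/-- The truncation of `n + p` to `ℕ^k`. -/
def truncAdd (n : Fin k → ℕ) (p : Fin k → ℤ) : Fin k → ℕ := fun i => ((n i : ℤ) + p i).toNat

/-- An ultrafilter on `ℕ^k` which contains all cofinal segments. -/
noncomputable def ultra (k : ℕ) : Ultrafilter (Fin k → ℕ) := Ultrafilter.of atTop

/-- Truncation at `0` has no effect once `n ≥ -p`, which holds along the ultrafilter. -/
theorem eventually_truncAdd (m : Fin k → ℕ) (p : Fin k → ℤ) :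
    ∀ᶠ n in (ultra k : Filter (Fin k → ℕ)),
      truncAdd n (p + fun i => (m i : ℤ)) = m + truncAdd n p := by
  refine Ultrafilter.of_le atTop ?_
  filter_upwards [mem_atTop fun i => (-p i).toNat] with n hn
  funext i
  have : (-p i).toNat ≤ n i := hn i
  simp only [truncAdd, Pi.add_apply]
  omega

/-- The limit of `c(λ, y(0, n + p))` as `n` tends to infinity along an ultrafilter. -/
noncomputable def phase (c : Λ → Λ → Circle) (l : Λ) (y : InfPath Λ) (p : Fin k → ℤ) : Circle :=
  ((ultra k).map fun n => c l (y.init (truncAdd n p))).lim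

/-- The limit exists because the circle is compact. -/
theorem tendsto_phase (c : Λ → Λ → Circle) (l : Λ) (y : InfPath Λ) (p : Fin k → ℤ) :
    Tendsto (fun n => c l (y.init (truncAdd n p))) (ultra k) (𝓝 (phase c l y p)) :=
  Ultrafilter.le_nhds_lim ((ultra k).map fun n => c l (y.init (truncAdd n p)))

theorem phase_vertex {c : Λ → Λ → Circle} (hc : IsTwoCocycle c) {v : Λ} (hv : deg v = 0)
    {y : InfPath Λ} (hy : y.range = v) (p : Fin k → ℤ) : phase c v y p = 1 := by
  refine tendsto_nhds_unique (tendsto_phase c v y p) ?_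
  have : (fun n => c v (y.init (truncAdd n p))) = fun _ => 1 := by
    funext n
    exact hc.normalised _ _ (by rw [r_init, hy, s_eq_self hv]) (Or.inl hv)
  rw [this]
  exact tendsto_const_nhds

/-- This is the limit of the cocycle identity for `(μ, ν, y(0, n + p))`. As `ν y(0, n + p)` is the
initial segment of `z = νy` of degree `n + p + d(ν)`, the parameter of the first phase must grow by
`d(ν)`. -/
theorem phase_mul {c : Λ → Λ → Circle} (hc : IsTwoCocycle c) {μ ν : Λ} (h : s μ = r ν)
    {y z : InfPath Λ} (hz : IsConcat ν y z) (p : Fin k → ℤ) :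
    phase c μ z (p + fun i => (deg ν i : ℤ)) * phase c ν y p =
      c μ ν * phase c (comp μ ν) y p := by
  refine tendsto_nhds_unique ((tendsto_phase c μ z _).mul (tendsto_phase c ν y p)) ?_
  refine ((tendsto_phase c (comp μ ν) y p).const_mul (c μ ν)).congr' ?_
  filter_upwards [eventually_truncAdd (deg ν) p] with n hn
  rw [hn, init_eq_comp hz, mul_comm (c μ (comp ν (y.init (truncAdd n p))))]
  exact hc.cocycle _ _ _ h (by rw [r_init, hz.range_eq])

open Classical in
/-- The weight of the operator which represents `l` on `ℓ²(Λ^∞ × ℤ^k)`. -/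
noncomputable def pathWeight (c : Λ → Λ → Circle) (l : Λ) (i : InfPath Λ × (Fin k → ℤ)) : ℂ :=
  if i.1.init (deg l) = l then
    (phase c l (i.1.shift (deg l)) (i.2 - fun j => (deg l j : ℤ)) : ℂ) else 0

/-- The partial map inverse to `(y, p) ↦ (ly, p + d(l))`. -/
def pathShift (l : Λ) (i : InfPath Λ × (Fin k → ℤ)) : InfPath Λ × (Fin k → ℤ) :=
  (i.1.shift (deg l), i.2 - fun j => (deg l j : ℤ))

theorem pathWeight_ne_zero {c : Λ → Λ → Circle} {l : Λ} {i : InfPath Λ × (Fin k → ℤ)} :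
    pathWeight c l i ≠ 0 ↔ i.1.init (deg l) = l := by
  rw [pathWeight]
  split_ifs with h
  · simp [h]
  · simp [h]

theorem norm_pathWeight_le (c : Λ → Λ → Circle) (l : Λ) (i : InfPath Λ × (Fin k → ℤ)) :
    ‖pathWeight c l i‖ ≤ 1 := by
  rw [pathWeight]
  split_ifs with h
  · rw [Circle.norm_coe]
  · simp

theorem pathShift_injOn {c : Λ → Λ → Circle} {l : Λ} (i j : InfPath Λ × (Fin k → ℤ))
    (hi : pathWeight c l i ≠ 0) (hj : pathWeight c l j ≠ 0) (h : pathShift l i = pathShift l j) :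
    i = j := by
  rw [pathWeight_ne_zero] at hi hj
  obtain ⟨h1, h2⟩ := Prod.ext_iff.1 h
  exact Prod.ext (eq_of_shift_eq' (deg l) (hi.trans hj.symm) h1) (sub_left_injective h2)

/-- The operator on `ℓ²(Λ^∞ × ℤ^k)` which maps the basis vector at `(y, p)` to a multiple of the
one at `(ly, p + d(l))`. -/
noncomputable def pathOp (c : Λ → Λ → Circle) (l : Λ) :
    lp (fun _ : InfPath Λ × (Fin k → ℤ) => ℂ) 2 →L[ℂ]
      lp (fun _ : InfPath Λ × (Fin k → ℤ) => ℂ) 2 :=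
  weightedComp (pathWeight c l) (pathShift l) (norm_pathWeight_le c l) pathShift_injOn

theorem pathOp_apply (c : Λ → Λ → Circle) (l : Λ)
    (ξ : lp (fun _ : InfPath Λ × (Fin k → ℤ) => ℂ) 2) (i : InfPath Λ × (Fin k → ℤ)) :
    pathOp c l ξ i = pathWeight c l i * ξ (pathShift l i) := rfl

theorem star_pathWeight_mul {c : Λ → Λ → Circle} {l : Λ} {i : InfPath Λ × (Fin k → ℤ)}
    (h : i.1.init (deg l) = l) : star (pathWeight c l i) * pathWeight c l i = 1 := by
  rw [pathWeight, if_pos h, Complex.star_def, ← Circle.coe_inv_eq_conj, ← Circle.coe_mul,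
    inv_mul_cancel, Circle.coe_one]

theorem exists_pathShift_eq {l : Λ} {i : InfPath Λ × (Fin k → ℤ)} (h : i.1.range = s l) :
    ∃ j, j.1.init (deg l) = l ∧ pathShift l j = i := by
  obtain ⟨z, hz⟩ := exists_isConcat h
  refine ⟨(z, i.2 + fun j => (deg l j : ℤ)), hz.1, Prod.ext hz.2 ?_⟩
  simp [pathShift]

theorem pathWeight_vertex {c : Λ → Λ → Circle} (hc : IsTwoCocycle c) {v : Λ} (hv : deg v = 0)
    {i : InfPath Λ × (Fin k → ℤ)} (h : i.1.range = v) : pathWeight c v i = 1 := by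
  have h0 : i.1.init (deg v) = v := by rw [hv, init_zero, h]
  have h1 : (i.1.shift (deg v)).range = v := by rw [hv, shift_zero, h]
  rw [pathWeight, if_pos h0, phase_vertex hc hv h1, Circle.coe_one]

theorem pathWeight_vertex_eq_zero (c : Λ → Λ → Circle) {v : Λ} (hv : deg v = 0)
    {i : InfPath Λ × (Fin k → ℤ)} (h : i.1.range ≠ v) : pathWeight c v i = 0 := by
  rw [pathWeight, if_neg]
  rwa [hv, init_zero]

theorem pathShift_vertex {v : Λ} (hv : deg v = 0) (i : InfPath Λ × (Fin k → ℤ)) :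
    pathShift v i = i := by
  refine Prod.ext ?_ ?_
  · rw [pathShift, hv, shift_zero]
  · rw [pathShift, hv]
    funext j
    simp

theorem star_pathOp_mul_self {c : Λ → Λ → Circle} (hc : IsTwoCocycle c) (l : Λ) :
    star (pathOp c l) * pathOp c l = pathOp c (s l) := by
  refine ContinuousLinearMap.ext fun ξ => lp.ext <| funext fun i => ?_
  rw [mul_apply_eq_comp, pathOp_apply, pathShift_vertex (deg_s l)]
  by_cases h : i.1.range = s l
  · obtain ⟨j, hj, rfl⟩ := exists_pathShift_eq h
    rw [pathOp, star_weightedComp_apply _ _ _ (pathWeight_ne_zero.2 hj), weightedComp_apply,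
      ← mul_assoc, star_pathWeight_mul hj, pathWeight_vertex hc (deg_s l) h]
  · rw [pathOp, star_weightedComp_apply_eq_zero, pathWeight_vertex_eq_zero c (deg_s l) h, zero_mul]
    intro j hj
    by_contra h0
    rw [← Ne, pathWeight_ne_zero] at h0
    refine h ?_
    rw [← hj, pathShift, ← s_init, h0]

theorem pathOp_mul {c : Λ → Λ → Circle} (hc : IsTwoCocycle c) {μ ν : Λ} (h : s μ = r ν) :
    pathOp c μ * pathOp c ν = (c μ ν : ℂ) • pathOp c (comp μ ν) := by
  refine ContinuousLinearMap.ext fun ξ => lp.ext <| funext fun i => ?_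
  have hsh : pathShift ν (pathShift μ i) = pathShift (comp μ ν) i := by
    refine Prod.ext ?_ ?_
    · simp only [pathShift]
      rw [deg_comp _ _ h, shift_shift]
    · funext j
      simp only [pathShift, deg_comp _ _ h, Pi.sub_apply, Pi.add_apply, Nat.cast_add]
      ring
  change pathOp c μ (pathOp c ν ξ) i = (c μ ν : ℂ) * pathOp c (comp μ ν) ξ i
  rw [pathOp_apply, pathOp_apply, pathOp_apply, hsh, ← mul_assoc, ← mul_assoc]
  congr 1
  by_cases hi : i.1.init (deg (comp μ ν)) = comp μ ν
  · have hi' := hi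
    rw [deg_comp _ _ h, init_add_eq_comp_iff h] at hi'
    have hz : IsConcat ν ((i.1.shift (deg μ)).shift (deg ν)) (i.1.shift (deg μ)) := ⟨hi'.2, rfl⟩
    -- The parameter left after removing both `μ` and `ν`; adding `d(ν)` back gives the one seen by
    -- the operator of `μ`.
    have hp := phase_mul hc h hz
      (i.2 - (fun j => (deg μ j : ℤ)) - fun j => (deg ν j : ℤ))
    rw [sub_add_cancel] at hp
    have hi2 : (pathShift μ i).1.init (deg ν) = ν := hi'.2
    rw [pathWeight, pathWeight, pathWeight, if_pos hi, if_pos hi'.1, if_pos hi2]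
    have e1 : i.1.shift (deg (comp μ ν)) = (pathShift ν (pathShift μ i)).1 := by rw [hsh]; rfl
    have e2 : (i.2 - fun j => (deg (comp μ ν) j : ℤ)) = (pathShift ν (pathShift μ i)).2 := by
      rw [hsh]; rfl
    rw [e1, e2, ← Circle.coe_mul, ← Circle.coe_mul]
    exact congrArg _ hp
  · have h0 : pathWeight c (comp μ ν) i = 0 := by rw [pathWeight, if_neg hi]
    rw [h0, mul_zero]
    by_contra h1
    obtain ⟨h2, h3⟩ := mul_ne_zero_iff.1 h1
    rw [pathWeight_ne_zero] at h2 h3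
    refine hi ?_
    rw [deg_comp _ _ h, init_add_eq_comp_iff h]
    exact ⟨h2, h3⟩

open Classical in
theorem pathOp_mul_star_apply (c : Λ → Λ → Circle) (l : Λ)
    (ξ : lp (fun _ : InfPath Λ × (Fin k → ℤ) => ℂ) 2) (i : InfPath Λ × (Fin k → ℤ)) :
    (pathOp c l * star (pathOp c l)) ξ i = if i.1.init (deg l) = l then ξ i else 0 := by
  rw [mul_apply_eq_comp, pathOp_apply]
  split_ifs with h
  · rw [pathOp, star_weightedComp_apply _ _ _ (pathWeight_ne_zero.2 h), ← mul_assoc,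
      mul_comm (pathWeight c l i), star_pathWeight_mul h, one_mul]
  · rw [pathWeight, if_neg h, zero_mul]

theorem isCKFamily_pathOp (hfin : RowFinite Λ) {c : Λ → Λ → Circle} (hc : IsTwoCocycle c) :
    IsCKFamily c (pathOp c) where
  ck1_proj v hv := by
    have hs : star (pathOp c v) * pathOp c v = pathOp c v := by
      rw [star_pathOp_mul_self hc, s_eq_self hv]
    have hsa : star (pathOp c v) = pathOp c v := by
      nth_rw 1 [← hs]
      rw [star_mul, star_star, hs]
    refine ⟨?_, hsa⟩
    rw [hsa] at hs
    exact hs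
  ck1_orth v w hv hw h := by
    refine ContinuousLinearMap.ext fun ξ => lp.ext <| funext fun i => ?_
    rw [mul_apply_eq_comp, pathOp_apply, pathOp_apply, pathShift_vertex hv]
    by_cases hi : i.1.range = v
    · rw [pathWeight_vertex_eq_zero c hw (by rwa [hi]), zero_mul, mul_zero]
      rfl
    · rw [pathWeight_vertex_eq_zero c hv hi, zero_mul]
      rfl
  ck2 _ _ h := pathOp_mul hc h
  ck3 := star_pathOp_mul_self hc
  ck4 v n hv := by
    classical
    rw [finsum_mem_eq_finite_toFinset_sum _ (hfin v n hv)]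
    refine ContinuousLinearMap.ext fun ξ => lp.ext <| funext fun i => ?_
    rw [_root_.sum_apply, lp.coeFn_sum, Finset.sum_apply, pathOp_apply,
      pathShift_vertex hv]
    simp only [pathOp_mul_star_apply]
    have hd : ∀ τ ∈ (hfin v n hv).toFinset, deg τ = n ∧ r τ = v := fun τ hτ =>
      ((Set.Finite.mem_toFinset _).1 hτ).symm
    by_cases hi : i.1.range = v
    · rw [Finset.sum_eq_single (i.1.init n), deg_init, if_pos rfl, pathWeight_vertex hc hv hi,
        one_mul]
      · intro τ hτ hne
        rw [(hd τ hτ).1, if_neg hne.symm]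
      · intro hn
        have hm : i.1.init n ∈ into v n := ⟨by rw [r_init, hi], deg_init _ _⟩
        exact absurd ((Set.Finite.mem_toFinset _).2 hm) hn
    · rw [pathWeight_vertex_eq_zero c hv hi, zero_mul]
      refine (Finset.sum_eq_zero fun τ hτ => if_neg fun hτ' => hi ?_).symm
      rw [← r_init i.1 (deg τ), hτ', (hd τ hτ).2]

theorem gen_ne_zero (hfin : RowFinite Λ) (hsrc : NoSources Λ) {c : Λ → Λ → Circle}
    (hc : IsTwoCocycle c) (l : Λ) : gen c l ≠ 0 := by
  classical
  intro h0
  obtain ⟨φ, hφ⟩ := exists_hom_of_isCKFamily (isCKFamily_pathOp hfin hc)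
  have h1 : pathOp c l = 0 := by rw [← hφ, h0, map_zero]
  obtain ⟨y, hy⟩ := exists_range_eq hfin hsrc (deg_s l)
  -- The index `j` belongs to the path `ly`; there the image of the basis vector at `(y, 0)` has a
  -- coefficient of modulus one.
  obtain ⟨j, hj, hjy⟩ := exists_pathShift_eq (l := l) (i := (y, 0)) hy
  have h2 : pathOp c l (lp.single 2 (y, 0) (1 : ℂ)) j = 0 := by
    rw [h1]
    rfl
  rw [pathOp_apply, hjy, lp.single_apply_self, mul_one] at h2
  exact pathWeight_ne_zero.2 hj h2

end PathRepresentation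

end KGraph

theorem mainTheorem7 {k : ℕ} {Λ : Type u} [KGraph k Λ] (hfin : KGraph.RowFinite Λ)
    (hsrc : KGraph.NoSources Λ) (c : Λ → Λ → Circle) (hc : KGraph.IsTwoCocycle c) :
    (∀ P : Set (Λ × Λ), KGraph.PathGroupoid.IsPartition P →
      (∀ l : Λ, (l, KGraph.s l) ∈ P) →
      ∃ (one : Λ → Λ → C_c(KGraph.PathGroupoid Λ, ℂ))
        (π : KGraph.TwistedCStar c →⋆ₙₐ[ℂ]
          KGraph.PathGroupoid.GroupoidCStar (KGraph.PathGroupoid.twist P c)),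
        (∀ μ ν : Λ, KGraph.s μ = KGraph.s ν →
          ⇑(one μ ν) = Set.indicator (KGraph.PathGroupoid.Z μ ν) (fun _ => (1 : ℂ))) ∧
        Function.Surjective π ∧
        (∀ l : Λ, π (KGraph.gen c l) = KGraph.PathGroupoid.ofCc _ (one l (KGraph.s l))) ∧
        ∀ μ ν : Λ, KGraph.s μ = KGraph.s ν →
          ∃ (F : Finset Λ) (a : Λ → Circle),
            (∀ τ ∈ F, KGraph.r τ = KGraph.s μ) ∧
            (F : Set Λ).PairwiseDisjoint
              (fun τ => KGraph.PathGroupoid.Z (KGraph.comp μ τ) (KGraph.comp ν τ)) ∧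
            KGraph.PathGroupoid.Z μ ν =
              ⋃ τ ∈ F, KGraph.PathGroupoid.Z (KGraph.comp μ τ) (KGraph.comp ν τ) ∧
            π (KGraph.gen c μ * star (KGraph.gen c ν)) =
              ∑ τ ∈ F, (a τ : ℂ) •
                KGraph.PathGroupoid.ofCc _ (one (KGraph.comp μ τ) (KGraph.comp ν τ))) ∧
    ∀ l : Λ, KGraph.gen c l ≠ 0 := by
  refine ⟨fun P hP hPs => ?_, KGraph.gen_ne_zero hfin hsrc hc⟩
  refine ⟨KGraph.PathGroupoid.one hfin,
    KGraph.PathGroupoid.toGroupoid hfin hsrc hP hPs hc,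
    fun μ ν h => KGraph.PathGroupoid.coe_one hfin h,
    KGraph.PathGroupoid.toGroupoid_surjective hfin hsrc hP hPs hc,
    KGraph.PathGroupoid.toGroupoid_gen hfin hsrc hP hPs hc, fun μ ν h => ?_⟩
  obtain ⟨n, hn⟩ := KGraph.PathGroupoid.exists_subordinate' hP hfin hsrc h
  choose! w hw γ hγ h1 h2 using hn
  have hF := hfin (KGraph.s μ) n (KGraph.deg_s μ)
  refine ⟨hF.toFinset, fun τ => KGraph.PathGroupoid.ratio c μ ν τ *
    (KGraph.PathGroupoid.ratio c (w τ).1 (w τ).2 (γ τ))⁻¹, ?_, ?_, ?_, ?_⟩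
  · exact fun τ hτ => ((Set.Finite.mem_toFinset _).1 hτ).1
  · rw [Set.Finite.coe_toFinset]
    exact KGraph.PathGroupoid.pairwiseDisjoint_Z_comp h n
  · simp only [Set.Finite.mem_toFinset]
    exact KGraph.PathGroupoid.Z_eq_iUnion h n
  · rw [← KGraph.PathGroupoid.ofCc_sum_smul]
    exact KGraph.PathGroupoid.toGroupoid_gen_mul_star hfin hsrc hP hPs hc
      (KGraph.PathGroupoid.conv_one_invol_eq_step hfin hP hPs hc h hw hγ h1 h2)
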